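/- Let $\mathbb{H}$ be the quaternions, let $X^{\mathsf H}$ denote the conjugate transpose of a quaternionic matrix, and let $\mathrm{Sp}(n)=\{Q\in\mathbb{H}^{n\times n}: Q^{\mathsf H}Q=I\}$ be the compact symplectic group, which is an embedded submanifold of $\mathbb{H}^{n\times n}$. Let $\mathsf{Q}^2(\mathbb{H}^n)=\{X\in\mathbb{H}^{n\times n}:X^{\mathsf H}=X\}$. Each set of matrices on the left below is an embedded smooth submanifold of the space of matrices; each coset space on the right is a smooth manifold with the unique smooth structure for which the projection from $\mathrm{Sp}(n)$ is a smooth submersion; and there are $\mathrm{Sp}(n)$-equivariant diffeomorphisms as follows. (1) (Stiefel manifold) For $0\le k\le n$, $$\{X\in\mathbb{H}^{n\times k}: X^{\mathsf H}X=I\}\;\cong\;\mathrm{Sp}(n)/\mathrm{Sp}(n-k),$$ where $\mathrm{Sp}(n)$ acts on the left side by $Q\cdot X=QX$, and $\mathrm{Sp}(n-k)$ is the subgroup $\{\mathrm{diag}(I_k,W):W\in\mathrm{Sp}(n-k)\}$. The coset of $Q$ corresponds to the matrix of the first $k$ columns of $Q$. (2) (Grassmann manifold) For $0\le k\le n$ and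 $\Delta=\mathrm{diag}(I_k,-I_{n-k})$, $$\{Q\Delta Q^{\mathsf H}\in\mathsf{Q}^2(\mathbb{H}^n):Q\in\mathrm{Sp}(n)\}\;\cong\;\mathrm{Sp}(n)/\bigl(\mathrm{Sp}(k)\times\mathrm{Sp}(n-k)\bigr).$$ (3) (Flag manifold) For integers $0<k_1<\dots<k_p<n$, with $k_0=0$ and $k_{p+1}=n$, for pairwise distinct real numbers $a_1,\dots,a_{p+1}$ and $\Delta_a=\mathrm{diag}(a_1I_{k_1-k_0},\dots,a_{p+1}I_{k_{p+1}-k_p})$, $$\{Q\Delta_aQ^{\mathsf H}\in\mathsf{Q}^2(\mathbb{H}^n):Q\in\mathrm{Sp}(n)\}\;\cong\;\mathrm{Sp}(n)/\bigl(\mathrm{Sp}(k_1)\times\mathrm{Sp}(k_2-k_1)\times\dots\times\mathrm{Sp}(n-k_p)\bigr).$$ In (2) and (3), $\mathrm{Sp}(n)$ acts on the left side by conjugation, $P\cdot X=PXP^{\mathsf H}$, the products of groups are embedded in $\mathrm{Sp}(n)$ as block-diagonal matrices, and the coset of $Q$ corresponds to $Q\Delta Q^{\mathsf H}$, respectively $Q\Delta_aQ^{\mathsf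 H}$. In all cases $\mathrm{Sp}(n)$ acts on the coset space by left multiplication. -/

import Mathlib

open scoped Manifold ContDiff Quaternion Matrix

/- Any norm on a space of matrices induces the same smooth structure; the entrywise sup norm,
whose topology is Mathlib's topology on matrices, is used to view `ℍ^{m × n}` as a normed space. -/
attribute [local instance] Matrix.normedAddCommGroup Matrix.normedSpace

noncomputable section

/-! ### The groups -/

/-- `ℍ^{m × n}`, the `m × n` quaternionic matrices. -/
abbrev QMat (m n : ℕ) : Type := Matrix (Fin m) (Fin n) ℍ[ℝ]

/-- The compact symplectic group `Sp(n)` of quaternionic unitary `n × n` matrices. It carries the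
subspace topology of `ℍ^{n × n}`. -/
abbrev CompactSp (n : ℕ) : Type := unitary (QMat n n)

/-- `Sp(n) = {Q : Qᴴ Q = 1}`: the condition `Q Qᴴ = 1` is automatic. -/
theorem mem_compactSp_iff {n : ℕ} {Q : QMat n n} : Q ∈ unitary (QMat n n) ↔ Qᴴ * Q = 1 := by
  rw [Unitary.mem_iff, Matrix.star_eq_conjTranspose]
  exact ⟨fun h => h.1, fun h => ⟨h, mul_eq_one_symm h⟩⟩

/-! ### Block-diagonal matrices with two blocks -/

/-- The first `k` and the last `n - k` of the `n` indices. -/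
def twoBlockEquiv {n k : ℕ} (hk : k ≤ n) : Fin k ⊕ Fin (n - k) ≃ Fin n :=
  finSumFinEquiv.trans (finCongr (Nat.add_sub_of_le hk))

/-- `diag(A, B)`. -/
def twoBlock {n k : ℕ} (hk : k ≤ n) (A : QMat k k) (B : QMat (n - k) (n - k)) : QMat n n :=
  Matrix.reindex (twoBlockEquiv hk) (twoBlockEquiv hk) (Matrix.fromBlocks A 0 0 B)

theorem twoBlock_one {n k : ℕ} (hk : k ≤ n) : twoBlock hk 1 1 = 1 := by
  simp [twoBlock]

theorem twoBlock_mul {n k : ℕ} (hk : k ≤ n) (A A' : QMat k k) (B B' : QMat (n - k) (n - k)) :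
    twoBlock hk (A * A') (B * B') = twoBlock hk A B * twoBlock hk A' B' := by
  simp [twoBlock, Matrix.submatrix_mul_equiv, Matrix.fromBlocks_multiply]

theorem twoBlock_conjTranspose {n k : ℕ} (hk : k ≤ n) (A : QMat k k) (B : QMat (n - k) (n - k)) :
    (twoBlock hk A B)ᴴ = twoBlock hk Aᴴ Bᴴ := by
  simp [twoBlock, Matrix.conjTranspose_submatrix, Matrix.fromBlocks_conjTranspose]

/-- The embedding `Sp(k) × Sp(n - k) → Sp(n)`, `(U, W) ↦ diag(U, W)`. -/
def twoBlockHom {n k : ℕ} (hk : k ≤ n) : CompactSp k × CompactSp (n - k) →* CompactSp n where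
  toFun W := ⟨twoBlock hk W.1 W.2, mem_compactSp_iff.2 (by
    rw [twoBlock_conjTranspose, ← twoBlock_mul, mem_compactSp_iff.1 W.1.2,
      mem_compactSp_iff.1 W.2.2, twoBlock_one])⟩
  map_one' := Subtype.ext (twoBlock_one hk)
  map_mul' _ _ := Subtype.ext (twoBlock_mul hk _ _ _ _)

/-- `Sp(n - k)` as the subgroup `{diag(I_k, W) : W ∈ Sp(n - k)}` of `Sp(n)`. -/
def stiefelSubgroup {n k : ℕ} (hk : k ≤ n) : Subgroup (CompactSp n) :=
  ((twoBlockHom hk).comp (MonoidHom.inr (CompactSp k) (CompactSp (n - k)))).range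

/-- `Sp(k) × Sp(n - k)` as the subgroup `{diag(U, W)}` of `Sp(n)`. -/
def grassmannSubgroup {n k : ℕ} (hk : k ≤ n) : Subgroup (CompactSp n) :=
  (twoBlockHom hk).range

/-- `Δ = diag(I_k, -I_{n-k})`. -/
def grassmannDelta {n k : ℕ} (hk : k ≤ n) : QMat n n := twoBlock hk 1 (-1)

/-! ### Block-diagonal matrices with `p + 1` blocks -/

/-- The sequence `k_0 = 0, k_1, …, k_p, k_{p+1} = n`. -/
def flagBound (n : ℕ) {p : ℕ} (k : Fin p → ℕ) : Fin (p + 2) → ℕ :=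
  Fin.cons (α := fun _ => ℕ) 0 (Fin.snoc (α := fun _ => ℕ) k n)

/-- The block sizes `k_1 - k_0, …, k_{p+1} - k_p`. -/
def flagSize (n : ℕ) {p : ℕ} (k : Fin p → ℕ) (j : Fin (p + 1)) : ℕ :=
  flagBound n k j.succ - flagBound n k j.castSucc

theorem flagBound_monotone {n p : ℕ} {k : Fin p → ℕ} (hk : StrictMono k) (hn : ∀ j, k j < n) :
    Monotone (flagBound n k) := by
  intro x y hxy
  induction x using Fin.cases with
  | zero => simp [flagBound]
  | succ x =>
    induction y using Fin.cases with
    | zero => simp at hxy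
    | succ y =>
      rw [Fin.succ_le_succ_iff] at hxy
      simp only [flagBound, Fin.cons_succ]
      induction y using Fin.lastCases with
      | last =>
        induction x using Fin.lastCases with
        | last => exact le_rfl
        | cast x => simpa using (hn x).le
      | cast y =>
        induction x using Fin.lastCases with
        | last => exact absurd hxy (not_le.2 (Fin.castSucc_lt_last y))
        | cast x => simpa using hk.monotone (by simpa using hxy)

theorem sum_flagSize {n p : ℕ} {k : Fin p → ℕ} (hk : StrictMono k) (hn : ∀ j, k j < n) :
    ∑ j, flagSize n k j = n := by
  have key : ∀ (m : ℕ) (f : Fin (m + 1) → ℕ), Monotone f →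
      ∑ j : Fin m, (f j.succ - f j.castSucc) = f (Fin.last m) - f 0 := by
    intro m
    induction m with
    | zero => intro f _; simp
    | succ m ih =>
      intro f hf
      rw [Fin.sum_univ_castSucc]
      have := ih (fun i => f i.castSucc) (fun a b h => hf (by simpa using h))
      simp only [Fin.succ_castSucc, Fin.castSucc_zero, Fin.succ_last] at this ⊢
      rw [this]
      have h1 : f 0 ≤ f (Fin.last m).castSucc := hf (Fin.zero_le _)
      have h2 : f (Fin.last m).castSucc ≤ f (Fin.last m.succ) := hf (Fin.le_last _)
      change f (Fin.last m).castSucc - f 0 + (f (Fin.last m.succ) - f (Fin.last m).castSucc) =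
        f (Fin.last m.succ) - f 0
      omega
  have := key (p + 1) (flagBound n k) (flagBound_monotone hk hn)
  simp only [flagSize, this]
  simp [flagBound, ← Fin.succ_last]

/-- The consecutive blocks of `k_1 - k_0, …, k_{p+1} - k_p` indices among the `n` indices. -/
def flagEquiv {n p : ℕ} {k : Fin p → ℕ} (hk : StrictMono k) (hn : ∀ j, k j < n) :
    (Σ j : Fin (p + 1), Fin (flagSize n k j)) ≃ Fin n :=
  finSigmaFinEquiv.trans (finCongr (sum_flagSize hk hn))

/-- `diag(M_1, …, M_{p+1})`. -/
def flagBlock {n p : ℕ} {k : Fin p → ℕ} (hk : StrictMono k) (hn : ∀ j, k j < n)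
    (M : ∀ j, QMat (flagSize n k j) (flagSize n k j)) : QMat n n :=
  Matrix.reindex (flagEquiv hk hn) (flagEquiv hk hn) (Matrix.blockDiagonal' M)

theorem flagBlock_one {n p : ℕ} {k : Fin p → ℕ} (hk : StrictMono k) (hn : ∀ j, k j < n) :
    flagBlock hk hn (fun _ => 1) = 1 := by
  have : Matrix.blockDiagonal' (fun j => (1 : QMat (flagSize n k j) (flagSize n k j))) = 1 :=
    Matrix.blockDiagonal'_one
  simp [flagBlock, this]

theorem flagBlock_mul {n p : ℕ} {k : Fin p → ℕ} (hk : StrictMono k) (hn : ∀ j, k j < n)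
    (M N : ∀ j, QMat (flagSize n k j) (flagSize n k j)) :
    flagBlock hk hn (fun j => M j * N j) = flagBlock hk hn M * flagBlock hk hn N := by
  simp [flagBlock, Matrix.submatrix_mul_equiv, Matrix.blockDiagonal'_mul]

theorem flagBlock_conjTranspose {n p : ℕ} {k : Fin p → ℕ} (hk : StrictMono k)
    (hn : ∀ j, k j < n) (M : ∀ j, QMat (flagSize n k j) (flagSize n k j)) :
    (flagBlock hk hn M)ᴴ = flagBlock hk hn (fun j => (M j)ᴴ) := by
  simp [flagBlock, Matrix.conjTranspose_submatrix, Matrix.blockDiagonal'_conjTranspose]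

/-- The embedding `Sp(k_1) × Sp(k_2 - k_1) × ⋯ × Sp(n - k_p) → Sp(n)`,
`(W_1, …, W_{p+1}) ↦ diag(W_1, …, W_{p+1})`. -/
def flagBlockHom {n p : ℕ} {k : Fin p → ℕ} (hk : StrictMono k) (hn : ∀ j, k j < n) :
    (∀ j, CompactSp (flagSize n k j)) →* CompactSp n where
  toFun W := ⟨flagBlock hk hn (fun j => W j), mem_compactSp_iff.2 (by
    rw [flagBlock_conjTranspose, ← flagBlock_mul, ← flagBlock_one hk hn]
    exact congrArg _ (funext fun j => mem_compactSp_iff.1 (W j).2))⟩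
  map_one' := Subtype.ext (flagBlock_one hk hn)
  map_mul' _ _ := Subtype.ext (flagBlock_mul hk hn _ _)

/-- `Sp(k_1) × Sp(k_2 - k_1) × ⋯ × Sp(n - k_p)` as the subgroup of block-diagonal matrices
of `Sp(n)`. -/
def flagSubgroup {n p : ℕ} {k : Fin p → ℕ} (hk : StrictMono k) (hn : ∀ j, k j < n) :
    Subgroup (CompactSp n) :=
  (flagBlockHom hk hn).range

/-- `Δ_a = diag(a_1 I_{k_1 - k_0}, …, a_{p+1} I_{k_{p+1} - k_p})`. -/
def flagDelta {n p : ℕ} {k : Fin p → ℕ} (hk : StrictMono k) (hn : ∀ j, k j < n)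
    (a : Fin (p + 1) → ℝ) : QMat n n :=
  flagBlock hk hn (fun j => a j • 1)

/-! ### The sets of matrices and the actions of `Sp(n)` -/

/-- `{X ∈ ℍ^{n × k} : Xᴴ X = I}`. -/
def quatStiefel (n k : ℕ) : Set (QMat n k) := {X | Xᴴ * X = 1}

/-- `Sp(n)` acts on `{X : Xᴴ X = I}` by left multiplication. -/
instance quatStiefel.instMulAction (n k : ℕ) : MulAction (CompactSp n) (quatStiefel n k) where
  smul Q X := ⟨(Q : QMat n n) * (X : QMat n k), by
    have hX : (X : QMat n k)ᴴ * (X : QMat n k) = 1 := X.2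
    have hQ := mem_compactSp_iff.1 Q.2
    change ((Q : QMat n n) * (X : QMat n k))ᴴ * ((Q : QMat n n) * (X : QMat n k)) = 1
    rw [Matrix.conjTranspose_mul, Matrix.mul_assoc, ← Matrix.mul_assoc (Q : QMat n n)ᴴ, hQ,
      Matrix.one_mul, hX]⟩
  one_smul X := Subtype.ext (Matrix.one_mul _)
  mul_smul P Q X := Subtype.ext (Matrix.mul_assoc _ _ _)

/-- `{Q D Qᴴ ∈ 𝖰²(ℍⁿ) : Q ∈ Sp(n)}`, where `𝖰²(ℍⁿ) = {X : Xᴴ = X}`. -/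
def quatConjOrbit {n : ℕ} (D : QMat n n) : Set (QMat n n) :=
  {X | Xᴴ = X ∧ ∃ Q : CompactSp n, X = (Q : QMat n n) * D * (Q : QMat n n)ᴴ}

/-- `Sp(n)` acts on `{Q D Qᴴ}` by conjugation, `P • X = P X Pᴴ`. -/
instance quatConjOrbit.instMulAction {n : ℕ} (D : QMat n n) :
    MulAction (CompactSp n) (quatConjOrbit D) where
  smul P X := ⟨(P : QMat n n) * (X : QMat n n) * (P : QMat n n)ᴴ, by
    obtain ⟨X, hX, Q, hQ⟩ := X
    refine ⟨?_, P * Q, ?_⟩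
    · simp only [Matrix.conjTranspose_mul, Matrix.conjTranspose_conjTranspose, hX,
        Matrix.mul_assoc]
    · simp only [hQ, Submonoid.coe_mul, Matrix.conjTranspose_mul, Matrix.mul_assoc]⟩
  one_smul X := Subtype.ext (by
    change (1 : QMat n n) * (X : QMat n n) * (1 : QMat n n)ᴴ = _
    simp)
  mul_smul P Q X := Subtype.ext (by
    change ((P : QMat n n) * (Q : QMat n n)) * (X : QMat n n) * ((P : QMat n n) * (Q : QMat n n))ᴴ
      = (P : QMat n n) * ((Q : QMat n n) * (X : QMat n n) * (Q : QMat n n)ᴴ) * (P : QMat n n)ᴴ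
    simp only [Matrix.conjTranspose_mul, Matrix.mul_assoc])

/-! ### Smooth structures -/

/-- The atlas `c` makes `M` an embedded smooth `d`-dimensional submanifold of the normed space `E`
through `ι : M → E`. There is at most one such smooth structure. -/
structure IsEmbeddedStructure {M E : Type} [TopologicalSpace M] [NormedAddCommGroup E]
    [NormedSpace ℝ E] (ι : M → E) (d : ℕ) (c : ChartedSpace (EuclideanSpace ℝ (Fin d)) M) :
    Prop where
  isManifold : IsManifold (𝓡 d) ∞ M
  isSmoothEmbedding : Manifold.IsSmoothEmbedding (𝓡 d) 𝓘(ℝ, E) ∞ ι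

/-- The atlas `c` makes the coset space `G ⧸ H` (with the quotient topology) a smooth homogeneous
space of `G`: it is a smooth manifold and the projection `G → G ⧸ H` is a smooth submersion.
There is at most one such smooth structure. -/
structure IsHomogeneousStructure {G : Type} [Group G] [TopologicalSpace G] (m : ℕ)
    (cG : ChartedSpace (EuclideanSpace ℝ (Fin m)) G) (H : Subgroup G) (d : ℕ)
    (c : ChartedSpace (EuclideanSpace ℝ (Fin d)) (G ⧸ H)) : Prop where
  isManifold : IsManifold (𝓡 d) ∞ (G ⧸ H)
  isSubmersion : Manifold.IsSubmersion (𝓡 m) (𝓡 d) ∞ (QuotientGroup.mk : G → G ⧸ H)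

/-- `S` is an embedded submanifold of `E`, the coset space `Sp(n) ⧸ H` is a smooth homogeneous
space, and there is an `Sp(n)`-equivariant diffeomorphism `S ≅ Sp(n) ⧸ H` under which the coset of
`Q` corresponds to the point `f Q` of `S`. Smoothness refers to the embedded structures of `Sp(n)`
(in `ℍ^{n × n}`) and of `S` (in `E`), and to the homogeneous structure of `Sp(n) ⧸ H`. -/
structure IsEquivariantModel {n : ℕ} {E : Type} [NormedAddCommGroup E] [NormedSpace ℝ E]
    (S : Set E) [MulAction (CompactSp n) S] (H : Subgroup (CompactSp n)) (f : CompactSp n → E) :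
    Prop where
  exists_embedded :
    ∃ (d : ℕ) (c : ChartedSpace (EuclideanSpace ℝ (Fin d)) S),
      IsEmbeddedStructure (Subtype.val : S → E) d c
  exists_homogeneous :
    ∀ (m : ℕ) (cG : ChartedSpace (EuclideanSpace ℝ (Fin m)) (CompactSp n)),
      IsEmbeddedStructure (Subtype.val : CompactSp n → QMat n n) m cG →
      ∃ (d : ℕ) (c : ChartedSpace (EuclideanSpace ℝ (Fin d)) (CompactSp n ⧸ H)),
        IsHomogeneousStructure m cG H d c
  exists_diffeomorph :
    ∀ (m : ℕ) (cG : ChartedSpace (EuclideanSpace ℝ (Fin m)) (CompactSp n))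
      (d : ℕ) (cS : ChartedSpace (EuclideanSpace ℝ (Fin d)) S)
      (d' : ℕ) (cQ : ChartedSpace (EuclideanSpace ℝ (Fin d')) (CompactSp n ⧸ H)),
      IsEmbeddedStructure (Subtype.val : CompactSp n → QMat n n) m cG →
      IsEmbeddedStructure (Subtype.val : S → E) d cS →
      IsHomogeneousStructure m cG H d' cQ →
      ∃ φ : S ≃ₘ^∞⟮𝓡 d, 𝓡 d'⟯ (CompactSp n ⧸ H),
        (∀ (P : CompactSp n) (X : S), φ (P • X) = P • φ X) ∧
        ∀ Q : CompactSp n, (φ.symm (Q : CompactSp n ⧸ H) : E) = f Q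

end

/-!
An orbit of a linear action of `Sp(n)` on a space of matrices is an embedded submanifold as soon as
the orbit map `Q ↦ Q • x₀` has a smooth local section, defined on a neighbourhood of `x₀` in the
ambient space and with values in `Sp(n)`: composing the section with the orbit map gives a smooth
local retraction of the ambient space onto the orbit, whose derivative at `x₀` is a projection that
linearizes the orbit there, and translation moves this chart to every other point. The same section
splits the projection `Sp(n) → Sp(n) / Stab(x₀)`, which makes it a submersion and the bijection
between orbit and coset space a diffeomorphism.

The section is the unitary polar factor `W (Wᴴ W)^(-1/2)` of an explicit matrix `W(X)`, equal to `1`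
at the base point. For the Stiefel manifold `W(X)` carries the base frame to the frame `X`. For the
orbit of a Hermitian matrix `D` annihilated by a split separable real polynomial, `W(X)` is the sum
of the products of the spectral projections of `X` and of `D`, so that `X W = W D`; taking the polar
factor preserves both relations.
-/

/-! ### Slice charts -/

section Slice

open Set Filter Topology

variable {E E₁ F : Type*} [NormedAddCommGroup E] [NormedSpace ℝ E]
  [NormedAddCommGroup E₁] [NormedSpace ℝ E₁] [NormedAddCommGroup F] [NormedSpace ℝ F]

theorem exists_openPartialHomeomorph_of_contDiffOn [CompleteSpace E] {f : E → F} {U : Set E}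
    {n : ℕ∞ω} (hf : ContDiffOn ℝ n f U) (hU : IsOpen U) (hn : 1 ≤ n) {a : E} (ha : a ∈ U)
    {f' : E ≃L[ℝ] F} (hf' : HasFDerivAt f (f' : E →L[ℝ] F) a) :
    ∃ e : OpenPartialHomeomorph E F, a ∈ e.source ∧ e.source ⊆ U ∧ (∀ x, e x = f x) ∧
      ContDiffOn ℝ n e e.source ∧ ContDiffOn ℝ n e.symm e.target := by
  have hn0 : n ≠ 0 := (zero_lt_one.trans_le hn).ne'
  have hfU : ∀ x ∈ U, ContDiffAt ℝ n f x := fun x hx => hf.contDiffAt (hU.mem_nhds hx)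
  -- The derivative is invertible on an open set, where the local inverse is smooth.
  set V := U ∩ fderiv ℝ f ⁻¹' range ((↑) : (E ≃L[ℝ] F) → E →L[ℝ] F)
  have hV : IsOpen V :=
    (hf.continuousOn_fderiv_of_isOpen hU hn).isOpen_inter_preimage hU ContinuousLinearEquiv.isOpen
  set e₀ := (hfU a ha).toOpenPartialHomeomorph f hf' hn0
  set e := e₀.restrOpen V hV
  have hsource : e.source = e₀.source ∩ V := e₀.restrOpen_source V hV
  have heV : e.source ⊆ V := hsource ▸ inter_subset_right
  refine ⟨e, hsource ▸ ⟨?_, ha, f', hf'.fderiv.symm⟩, heV.trans inter_subset_left, fun _ => rfl,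
    hf.mono (heV.trans inter_subset_left), fun y hy => ?_⟩
  · exact ContDiffAt.mem_toOpenPartialHomeomorph_source _ hf' hn0
  · obtain ⟨hxU, g, hg⟩ := heV (e.map_target hy)
    have hderiv : HasFDerivAt f (g : E →L[ℝ] F) (e.symm y) :=
      hg ▸ ((hfU _ hxU).differentiableAt hn0).hasFDerivAt
    exact (e.contDiffAt_symm hy hderiv (hfU _ hxU)).contDiffWithinAt

/-- `e` is a smooth chart of `E` which straightens the set `S` to `E₁ × {0}`, in the linear
decomposition `L` of `E`. -/
structure IsSliceChart (S : Set E) (L : (E₁ × F) ≃L[ℝ] E) (e : OpenPartialHomeomorph E E) :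
    Prop where
  contDiffOn : ContDiffOn ℝ ∞ e e.source
  contDiffOn_symm : ContDiffOn ℝ ∞ e.symm e.target
  mem_iff : ∀ y ∈ e.source, y ∈ S ↔ (L.symm (e y)).2 = 0

namespace IsSliceChart

variable {S : Set E} {L : (E₁ × F) ≃L[ℝ] E} {e e' : OpenPartialHomeomorph E E}

theorem comp_continuousLinearEquiv (he : IsSliceChart S L e) (T : E ≃L[ℝ] E)
    (hT : ∀ y, T y ∈ S ↔ y ∈ S) :
    IsSliceChart S L (T.toHomeomorph.transOpenPartialHomeomorph e) where
  contDiffOn := he.contDiffOn.comp T.contDiff.contDiffOn fun _ hx => hx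
  contDiffOn_symm := T.symm.contDiff.comp_contDiffOn he.contDiffOn_symm
  mem_iff y hy := by rw [← hT]; exact he.mem_iff (T y) hy

theorem prodCongr_left {E₂ : Type*} [NormedAddCommGroup E₂] [NormedSpace ℝ E₂]
    (he : IsSliceChart S L e) (A : E₂ ≃L[ℝ] E₁) :
    IsSliceChart S ((A.prodCongr (ContinuousLinearEquiv.refl ℝ F)).trans L) e where
  __ := he
  mem_iff := he.mem_iff

end IsSliceChart

end Slice

/-! ### Smooth local retractions -/

section Retraction

open Set Filter Topology

variable {E : Type*} [NormedAddCommGroup E] [NormedSpace ℝ E]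

/-- Near `x`, the map `r` is a smooth retraction of `E` onto `S`. Smoothness is `C^ω` because
`ContDiffAt ℝ ∞ r x` would not provide a neighbourhood of `x` on which `r` is `C^∞`. -/
structure IsSmoothRetractionAt (S : Set E) (r : E → E) (x : E) : Prop where
  contDiffAt : ContDiffAt ℝ ω r x
  apply_self : r x = x
  eventually_mem : ∀ᶠ y in 𝓝 x, r y ∈ S
  eventually_apply_eq : ∀ᶠ y in 𝓝 x, y ∈ S → r y = y

namespace IsSmoothRetractionAt

variable {S : Set E} {r : E → E} {x : E}

theorem tendsto (hr : IsSmoothRetractionAt S r x) : Tendsto r (𝓝 x) (𝓝 x) := by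
  simpa only [ContinuousAt, hr.apply_self] using hr.contDiffAt.continuousAt

theorem hasFDerivAt (hr : IsSmoothRetractionAt S r x) : HasFDerivAt r (fderiv ℝ r x) x :=
  (hr.contDiffAt.differentiableAt (by simp)).hasFDerivAt

theorem eventually_apply_apply (hr : IsSmoothRetractionAt S r x) :
    ∀ᶠ y in 𝓝 x, r (r y) = r y := by
  filter_upwards [hr.eventually_mem, hr.tendsto.eventually hr.eventually_apply_eq] with y h₁ h₂
  exact h₂ h₁

theorem isIdempotentElem_fderiv (hr : IsSmoothRetractionAt S r x) :
    IsIdempotentElem (fderiv ℝ r x) := by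
  have hcomp : HasFDerivAt (r ∘ r) ((fderiv ℝ r x).comp (fderiv ℝ r x)) x :=
    HasFDerivAt.comp x (by simpa only [hr.apply_self] using hr.hasFDerivAt) hr.hasFDerivAt
  exact hcomp.unique (hr.hasFDerivAt.congr_of_eventuallyEq hr.eventually_apply_apply)

/-- The map `φ y = P (r y) + (1 - P) (y - r y)`, where `P` is the derivative of `r` at `x`. It
straightens a set onto which `r` retracts to the range of `P`. -/
noncomputable def straightening (r : E → E) (x y : E) : E :=
  fderiv ℝ r x (r y) + ((y - r y) - fderiv ℝ r x (y - r y))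

theorem contDiffAt_straightening (hr : IsSmoothRetractionAt S r x) :
    ContDiffAt ℝ ω (straightening r x) x := by
  have hP := (fderiv ℝ r x).contDiff (n := ω)
  have hsub : ContDiffAt ℝ ω (fun y => y - r y) x := contDiffAt_id.sub hr.contDiffAt
  exact (hP.contDiffAt.comp x hr.contDiffAt).add (hsub.sub (hP.contDiffAt.comp x hsub))

theorem hasFDerivAt_straightening (hr : IsSmoothRetractionAt S r x) :
    HasFDerivAt (straightening r x) (ContinuousLinearEquiv.refl ℝ E : E →L[ℝ] E) x := by
  have hP : ∀ v, fderiv ℝ r x (fderiv ℝ r x v) = fderiv ℝ r x v :=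
    DFunLike.congr_fun hr.isIdempotentElem_fderiv
  have hsub := (hasFDerivAt_id (𝕜 := ℝ) x).sub hr.hasFDerivAt
  refine (((fderiv ℝ r x).hasFDerivAt.comp x hr.hasFDerivAt).add
    (hsub.sub ((fderiv ℝ r x).hasFDerivAt.comp x hsub))).congr_fderiv ?_
  ext v
  simp [hP]

theorem mem_iff_fderiv_straightening (hr : IsSmoothRetractionAt S r x) {V : Set E} (hV : V ∈ 𝓝 x)
    (hinj : InjOn (straightening r x) V) :
    ∀ᶠ y in 𝓝 x, y ∈ S ↔ fderiv ℝ r x (straightening r x y) = straightening r x y := by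
  have hP : ∀ v, fderiv ℝ r x (fderiv ℝ r x v) = fderiv ℝ r x v :=
    DFunLike.congr_fun hr.isIdempotentElem_fderiv
  filter_upwards [hr.eventually_mem, hr.eventually_apply_eq, hr.eventually_apply_apply, hV,
    hr.tendsto.eventually hV] with y hmem hfix hrr hyV hryV
  refine ⟨fun hy => by simp [straightening, hfix hy, hP], fun hy => ?_⟩
  have hcompl : (y - r y) - fderiv ℝ r x (y - r y) = 0 := by
    simpa [straightening, hP, sub_eq_zero, eq_comm] using hy
  have heq : straightening r x y = straightening r x (r y) := by
    rw [straightening, hcompl, straightening, hrr]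
    simp
  exact hinj hyV hryV heq ▸ hmem

/-- The decomposition of `E` into the range and the kernel of the derivative of a retraction. -/
noncomputable def decomposition (hr : IsSmoothRetractionAt S r x) :
    ((fderiv ℝ r x).range × (fderiv ℝ r x).ker) ≃L[ℝ] E :=
  Submodule.prodEquivOfIsTopCompl _ _
    (ContinuousLinearMap.IsIdempotentElem.isTopCompl hr.isIdempotentElem_fderiv)

theorem decomposition_symm_snd_eq_zero_iff (hr : IsSmoothRetractionAt S r x) (y : E) :
    (hr.decomposition.symm y).2 = 0 ↔ fderiv ℝ r x y = y := by
  rw [decomposition, Submodule.coe_symm_prodEquivOfIsTopCompl,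
    Submodule.prodEquivOfIsCompl_symm_apply_snd_eq_zero]
  exact LinearMap.IsIdempotentElem.mem_range_iff
    (ContinuousLinearMap.IsIdempotentElem.toLinearMap hr.isIdempotentElem_fderiv)

theorem exists_isSliceChart [CompleteSpace E] (hr : IsSmoothRetractionAt S r x) :
    ∃ e, IsSliceChart S hr.decomposition e ∧ x ∈ e.source := by
  obtain ⟨U, hU, hUo, hxU⟩ := mem_nhds_iff.1 (hr.contDiffAt_straightening.eventually (by simp))
  have hφ : ContDiffOn ℝ ω (straightening r x) U := fun y hy =>
    ContDiffAt.contDiffWithinAt (hU hy)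
  obtain ⟨e, hxe, -, he, hcont, hcont'⟩ :=
    exists_openPartialHomeomorph_of_contDiffOn hφ hUo (by simp) hxU hr.hasFDerivAt_straightening
  have hinj : InjOn (straightening r x) e.source := fun y hy z hz h =>
    e.injOn hy hz (by rw [he, he, h])
  obtain ⟨V, hV, hVo, hxV⟩ := mem_nhds_iff.1
    (hr.mem_iff_fderiv_straightening (e.open_source.mem_nhds hxe) hinj)
  have hsource : (e.restrOpen V hVo).source = e.source ∩ V := e.restrOpen_source V hVo
  refine ⟨e.restrOpen V hVo, ⟨?_, ?_, fun y hy => ?_⟩, hsource ▸ ⟨hxe, hxV⟩⟩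
  · exact (hcont.of_le (by simp)).mono (hsource ▸ inter_subset_left)
  · exact (hcont'.of_le (by simp)).mono fun y hy => hy.1
  · rw [hsource] at hy
    rw [hr.decomposition_symm_snd_eq_zero_iff]
    exact he y ▸ hV hy.2

end IsSmoothRetractionAt

end Retraction

/-! ### Embedded submanifolds of a normed space -/

section Embedded

open Set Filter Topology

namespace IsSliceChart

variable {E E₁ F : Type*} [NormedAddCommGroup E] [NormedSpace ℝ E]
  [NormedAddCommGroup E₁] [NormedSpace ℝ E₁] [NormedAddCommGroup F] [NormedSpace ℝ F]
  {M : Type*} {ι : M → E} {L : (E₁ × F) ≃L[ℝ] E}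
  {e e' : OpenPartialHomeomorph E E}

theorem apply_fst_symm (he : IsSliceChart (range ι) L e) {x : M} (hx : ι x ∈ e.source) :
    L ((L.symm (e (ι x))).1, 0) = e (ι x) := by
  rw [← (he.mem_iff _ hx).1 ⟨x, rfl⟩, Prod.mk.eta, L.apply_symm_apply]

variable [Nonempty M]

theorem apply_invFun (he : IsSliceChart (range ι) L e) {u : E₁} (hu : L (u, 0) ∈ e.target) :
    ι (Function.invFun ι (e.symm (L (u, 0)))) = e.symm (L (u, 0)) :=
  Function.invFun_eq ((he.mem_iff _ (e.map_target hu)).2 (by rw [e.right_inv hu]; simp))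

variable [TopologicalSpace M]

/-- The chart of `M` induced by a slice chart of the image of an embedding `ι : M → E`. -/
noncomputable def chart (hι : IsEmbedding ι) (he : IsSliceChart (range ι) L e) :
    OpenPartialHomeomorph M E₁ where
  toFun x := (L.symm (e (ι x))).1
  invFun u := Function.invFun ι (e.symm (L (u, 0)))
  source := ι ⁻¹' e.source
  target := {u | L (u, 0) ∈ e.target}
  map_source' x hx := by
    simpa only [mem_ofPred_eq, he.apply_fst_symm hx] using e.map_source hx
  map_target' u hu := by
    simpa only [mem_preimage, he.apply_invFun hu] using e.map_target hu
  left_inv' x hx := by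
    rw [he.apply_fst_symm hx, e.left_inv hx, Function.leftInverse_invFun hι.injective x]
  right_inv' u hu := by
    rw [he.apply_invFun hu, e.right_inv hu, L.symm_apply_apply]
  open_source := e.open_source.preimage hι.continuous
  open_target := e.open_target.preimage (by fun_prop)
  continuousOn_toFun := (continuous_fst.comp L.symm.continuous).comp_continuousOn
    (e.continuousOn.comp hι.continuous.continuousOn fun _ hx => hx)
  continuousOn_invFun := by
    have hL : Continuous fun u : E₁ => L (u, 0) := by fun_prop
    exact hι.continuousOn_iff.2 <|
      (e.continuousOn_symm.comp hL.continuousOn fun _ hu => hu).congr fun _ => he.apply_invFun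

variable (hι : IsEmbedding ι) (he : IsSliceChart (range ι) L e)
  (he' : IsSliceChart (range ι) L e')

theorem contDiffOn_chart_comp_chart_symm :
    ContDiffOn ℝ ∞ (he'.chart hι ∘ (he.chart hι).symm)
      ((he.chart hι).symm ≫ₕ he'.chart hι).source := by
  have hsource : ∀ u ∈ ((he.chart hι).symm ≫ₕ he'.chart hι).source,
      L (u, 0) ∈ e.target ∧ e.symm (L (u, 0)) ∈ e'.source := fun u hu =>
    ⟨hu.1, he.apply_invFun hu.1 ▸ hu.2⟩
  have hL : ContDiff ℝ ∞ fun u : E₁ => L (u, 0) :=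
    L.contDiff.comp (contDiff_id.prodMk contDiff_const)
  have hcomp : ContDiffOn ℝ ∞ (fun u => (L.symm (e' (e.symm (L (u, 0))))).1)
      ((he.chart hι).symm ≫ₕ he'.chart hι).source :=
    (contDiff_fst.comp L.symm.contDiff).comp_contDiffOn
      (he'.contDiffOn.comp
        (he.contDiffOn_symm.comp hL.contDiffOn fun u hu => (hsource u hu).1)
        fun u hu => (hsource u hu).2)
  exact hcomp.congr fun u hu => congrArg (fun y => (L.symm (e' y)).1) (he.apply_invFun hu.1)

theorem isImmersionAtOfComplement [ChartedSpace E₁ M]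
    (hchart : he.chart hι ∈ IsManifold.maximalAtlas 𝓘(ℝ, E₁) ∞ M) {x : M} (hx : ι x ∈ e.source) :
    Manifold.IsImmersionAtOfComplement F 𝓘(ℝ, E₁) 𝓘(ℝ, E) ∞ ι x := by
  refine Manifold.IsImmersionAtOfComplement.mk_of_charts L (he.chart hι) e hx hx hchart
    (e.mem_maximalAtlas_of_contMDiffOn he.contDiffOn.contMDiffOn he.contDiffOn_symm.contMDiffOn)
    (fun y hy => hy) fun u hu => ?_
  replace hu : u ∈ (he.chart hι).target := by simpa using hu
  exact (congrArg e (he.apply_invFun hu)).trans (e.right_inv hu)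

end IsSliceChart

theorem exists_isEmbeddedStructure_of_isSliceChart {d : ℕ} {M E F : Type} [TopologicalSpace M]
    [NormedAddCommGroup E] [NormedSpace ℝ E] [NormedAddCommGroup F] [NormedSpace ℝ F]
    {ι : M → E} (hι : IsEmbedding ι) (L : (EuclideanSpace ℝ (Fin d) × F) ≃L[ℝ] E)
    (h : ∀ x, ∃ e, IsSliceChart (range ι) L e ∧ ι x ∈ e.source) :
    ∃ c : ChartedSpace (EuclideanSpace ℝ (Fin d)) M, IsEmbeddedStructure ι d c := by
  choose e he hx using h
  let ch (x : M) : OpenPartialHomeomorph M (EuclideanSpace ℝ (Fin d)) :=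
    haveI : Nonempty M := ⟨x⟩
    (he x).chart hι
  let c : ChartedSpace (EuclideanSpace ℝ (Fin d)) M :=
    { atlas := range ch
      chartAt := ch
      mem_chart_source := hx
      chart_mem_atlas := mem_range_self }
  have hM : IsManifold (𝓡 d) ∞ M := by
    refine isManifold_of_contDiffOn _ _ _ ?_
    rintro _ _ ⟨x, rfl⟩ ⟨x', rfl⟩
    have : Nonempty M := ⟨x⟩
    exact ((he x).contDiffOn_chart_comp_chart_symm hι (he x')).mono (by simp [ch])
  refine ⟨c, hM, ?_, hι⟩
  refine Manifold.IsImmersionOfComplement.isImmersion (F := F) fun x => ?_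
  have : Nonempty M := ⟨x⟩
  exact (he x).isImmersionAtOfComplement hι
    (IsManifold.subset_maximalAtlas (mem_range_self (f := ch) x)) (hx x)

theorem exists_isEmbeddedStructure_of_retraction {M E : Type} [TopologicalSpace M]
    [NormedAddCommGroup E] [NormedSpace ℝ E] [FiniteDimensional ℝ E] {ι : M → E}
    (hι : IsEmbedding ι) {x₀ : M} {r : E → E} (hr : IsSmoothRetractionAt (range ι) r (ι x₀))
    (htrans : ∀ x, ∃ T : E ≃L[ℝ] E, T (ι x) = ι x₀ ∧ ∀ y, T y ∈ range ι ↔ y ∈ range ι) :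
    ∃ (d : ℕ) (c : ChartedSpace (EuclideanSpace ℝ (Fin d)) M), IsEmbeddedStructure ι d c := by
  have : CompleteSpace E := FiniteDimensional.complete ℝ E
  obtain ⟨e, he, hx₀⟩ := hr.exists_isSliceChart
  let A : EuclideanSpace ℝ (Fin (Module.finrank ℝ (fderiv ℝ r (ι x₀)).range)) ≃L[ℝ]
    (fderiv ℝ r (ι x₀)).range := ContinuousLinearEquiv.ofFinrankEq (by simp)
  refine ⟨_, exists_isEmbeddedStructure_of_isSliceChart hι
    ((A.prodCongr (ContinuousLinearEquiv.refl ℝ _)).trans hr.decomposition) fun x => ?_⟩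
  obtain ⟨T, hTx, hT⟩ := htrans x
  refine ⟨_, (he.prodCongr_left A).comp_continuousLinearEquiv T hT, ?_⟩
  exact show T (ι x) ∈ e.source from hTx ▸ hx₀

end Embedded

/-! ### Submersions and local sections -/

section Submersion

open Set Filter Topology Manifold

variable {E E' : Type*} [NormedAddCommGroup E] [NormedSpace ℝ E]
  [NormedAddCommGroup E'] [NormedSpace ℝ E']

theorem exists_openPartialHomeomorph_straightening [CompleteSpace E] {f : E → E'} {U : Set E}
    {n : ℕ∞ω} (hf : ContDiffOn ℝ n f U) (hU : IsOpen U) (hn : 1 ≤ n) {x : E} (hx : x ∈ U)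
    {B : E' →L[ℝ] E} (hB : Function.RightInverse B (fderiv ℝ f x)) :
    ∃ e : OpenPartialHomeomorph E E, x ∈ e.source ∧ e.source ⊆ U ∧
      ContDiffOn ℝ n e e.source ∧ ContDiffOn ℝ n e.symm e.target ∧
      ∀ u ∈ e.target, f (e.symm u) =
        (ContinuousLinearEquiv.equivOfRightInverse (fderiv ℝ f x) B hB u).1 := by
  set A := ContinuousLinearEquiv.equivOfRightInverse (fderiv ℝ f x) B hB
  let φ (u : E) : E := A.symm (f u, (A u).2)
  have hφ : ContDiffOn ℝ n φ U :=
    A.symm.contDiff.comp_contDiffOn (hf.prodMk (contDiff_snd.comp A.contDiff).contDiffOn)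
  have hφ' : HasFDerivAt φ (ContinuousLinearEquiv.refl ℝ E : E →L[ℝ] E) x := by
    have hfx : HasFDerivAt f (fderiv ℝ f x) x :=
      ((hf.contDiffAt (hU.mem_nhds hx)).differentiableAt (zero_lt_one.trans_le hn).ne').hasFDerivAt
    have hpair := hfx.prodMk ((ContinuousLinearMap.snd ℝ _ _).hasFDerivAt.comp x A.hasFDerivAt)
    refine (A.symm.hasFDerivAt.comp x hpair).congr_fderiv (ContinuousLinearMap.ext fun v => ?_)
    exact A.symm_apply_apply v
  obtain ⟨e, hxe, heU, he, hcont, hcont'⟩ :=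
    exists_openPartialHomeomorph_of_contDiffOn hφ hU hn hx hφ'
  refine ⟨e, hxe, heU, hcont, hcont', fun u hu => ?_⟩
  have hu' : A.symm (f (e.symm u), (A (e.symm u)).2) = u := (he _).symm.trans (e.right_inv hu)
  conv_rhs => rw [← hu', A.apply_symm_apply]

variable {F : Type*} [NormedAddCommGroup F] [NormedSpace ℝ F]
  {M N : Type*} [TopologicalSpace M] [TopologicalSpace N] [ChartedSpace E M] [ChartedSpace E' N]

theorem surjective_mfderiv_of_section {f : M → N} {s : N → M} {y : N}
    (hf : MDifferentiableAt 𝓘(ℝ, E) 𝓘(ℝ, E') f (s y))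
    (hs : MDifferentiableAt 𝓘(ℝ, E') 𝓘(ℝ, E) s y) (hfs : ∀ᶠ z in 𝓝 y, f (s z) = z) :
    Function.Surjective (mfderiv 𝓘(ℝ, E) 𝓘(ℝ, E') f (s y)) := by
  have hcomp := hasMFDerivAt_unique (hf.hasMFDerivAt.comp y hs.hasMFDerivAt)
    ((hasMFDerivAt_id y).congr_of_eventuallyEq hfs)
  exact fun v => ⟨mfderiv 𝓘(ℝ, E') 𝓘(ℝ, E) s y v, DFunLike.congr_fun hcomp v⟩

theorem exists_section_of_isSubmersionAtOfComplement {f : M → N} {x : M}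
    (hf : IsSubmersionAtOfComplement F 𝓘(ℝ, E) 𝓘(ℝ, E') ∞ f x) :
    ∃ s : N → M, ContMDiffAt 𝓘(ℝ, E') 𝓘(ℝ, E) ∞ s (f x) ∧ ∀ᶠ y in 𝓝 (f x), f (s y) = y := by
  set φ := hf.domChart
  set ψ := hf.codChart
  have hxφ : x ∈ φ.source := hf.mem_domChart_source
  have hxψ : f x ∈ ψ.source := hf.mem_codChart_source
  have hchart : ∀ u ∈ φ.target, ψ (f (φ.symm u)) = (hf.equiv u).1 := fun u hu =>
    hf.writtenInCharts (by simpa using hu)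
  let q (w : E') : E := hf.equiv.symm (w, (hf.equiv (φ x)).2)
  have hq : ContDiff ℝ ∞ q := hf.equiv.symm.contDiff.comp (contDiff_id.prodMk contDiff_const)
  have hqx : q (ψ (f x)) ∈ φ.target := by
    have hψx : ψ (f x) = (hf.equiv (φ x)).1 := by
      rw [← hchart _ (φ.map_source hxφ), φ.left_inv hxφ]
    simpa only [q, hψx, Prod.mk.eta, hf.equiv.symm_apply_apply] using φ.map_source hxφ
  have hqψ : ContMDiffAt 𝓘(ℝ, E') 𝓘(ℝ, E) ∞ (q ∘ ψ) (f x) :=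
    hq.contMDiff.contMDiffAt.comp _
      (contMDiffAt_of_mem_maximalAtlas hf.codChart_mem_maximalAtlas hxψ)
  refine ⟨φ.symm ∘ q ∘ ψ, ContMDiffAt.comp _
    (contMDiffAt_symm_of_mem_maximalAtlas hf.domChart_mem_maximalAtlas hqx) hqψ, ?_⟩
  filter_upwards [hqψ.continuousAt.eventually (φ.open_target.mem_nhds hqx),
    ψ.open_source.mem_nhds hxψ] with y hy hyψ
  refine ψ.injOn (hf.source_subset_preimage_source (φ.map_target hy)) hyψ ?_
  exact (hchart _ hy).trans (by simp [q])

theorem contMDiff_of_comp_isSubmersion {E'' H'' N' : Type*} [NormedAddCommGroup E'']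
    [NormedSpace ℝ E''] [TopologicalSpace H''] {I : ModelWithCorners ℝ E'' H''}
    [TopologicalSpace N'] [ChartedSpace H'' N'] {f : M → N}
    (hf : IsSubmersion 𝓘(ℝ, E) 𝓘(ℝ, E') ∞ f) (hsurj : Function.Surjective f) {h : N → N'}
    (hh : ContMDiff 𝓘(ℝ, E) I ∞ (h ∘ f)) : ContMDiff 𝓘(ℝ, E') I ∞ h := by
  intro y
  obtain ⟨x, rfl⟩ := hsurj y
  obtain ⟨F, _, _, hF⟩ := hf
  obtain ⟨s, hs, hfs⟩ := exists_section_of_isSubmersionAtOfComplement (hF x)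
  exact ((hh _).comp (f x) hs).congr_of_eventuallyEq (hfs.mono fun y hy => congrArg h hy.symm)

variable [IsManifold 𝓘(ℝ, E) ∞ M] [IsManifold 𝓘(ℝ, E') ∞ N]

theorem isSubmersionAtOfComplement_of_surjective_mfderiv [FiniteDimensional ℝ E]
    [FiniteDimensional ℝ E'] [FiniteDimensional ℝ F]
    (hF : Module.finrank ℝ F = Module.finrank ℝ E - Module.finrank ℝ E') {f : M → N}
    (hf : ContMDiff 𝓘(ℝ, E) 𝓘(ℝ, E') ∞ f) {x : M}
    (hx : Function.Surjective (mfderiv 𝓘(ℝ, E) 𝓘(ℝ, E') f x)) :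
    IsSubmersionAtOfComplement F 𝓘(ℝ, E) 𝓘(ℝ, E') ∞ f x := by
  have : CompleteSpace E := FiniteDimensional.complete ℝ E
  set c := chartAt E x
  set c' := chartAt E' (f x)
  have hc : c ∈ IsManifold.maximalAtlas 𝓘(ℝ, E) ∞ M := IsManifold.chart_mem_maximalAtlas x
  have hc' : c' ∈ IsManifold.maximalAtlas 𝓘(ℝ, E') ∞ N := IsManifold.chart_mem_maximalAtlas (f x)
  have hcx : x ∈ c.source := mem_chart_source E x
  have hcx' : f x ∈ c'.source := mem_chart_source E' (f x)
  let U := c.target ∩ c.symm ⁻¹' (f ⁻¹' c'.source)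
  have hU : IsOpen U :=
    c.continuousOn_symm.isOpen_inter_preimage c.open_target (c'.open_source.preimage hf.continuous)
  have hxU : c x ∈ U := ⟨c.map_source hcx, by simpa [c.left_inv hcx] using hcx'⟩
  have hg : ContDiffOn ℝ ∞ (c' ∘ f ∘ c.symm) U := by
    simpa only [mfld_simps] using (contMDiff_iff.1 hf).2 x (f x)
  have hg' : mfderiv 𝓘(ℝ, E) 𝓘(ℝ, E') f x = fderiv ℝ (c' ∘ f ∘ c.symm) (c x) := by
    simp only [mfderiv, (hf x).mdifferentiableAt (by simp), mfld_simps, fderivWithin_univ]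
    rfl
  obtain ⟨B, hB⟩ := (fderiv ℝ (c' ∘ f ∘ c.symm) (c x)).exists_rightInverse_of_surjective
    (LinearMap.range_eq_top.2 (hg' ▸ hx))
  obtain ⟨e, hxe, -, he, he', hfe⟩ :=
    exists_openPartialHomeomorph_straightening hg hU (by simp) hxU (DFunLike.congr_fun hB)
  let A := ContinuousLinearEquiv.equivOfRightInverse _ B (DFunLike.congr_fun hB)
  have hker : Module.finrank ℝ (fderiv ℝ (c' ∘ f ∘ c.symm) (c x)).ker = Module.finrank ℝ F := by
    rw [hF, A.toLinearEquiv.finrank_eq, Module.finrank_prod, Nat.add_sub_cancel_left]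
  refine IsSubmersionAtOfComplement.trans_F ?_ (ContinuousLinearEquiv.ofFinrankEq hker)
  refine IsSubmersionAtOfComplement.mk_of_continuousAt hf.continuous.continuousAt A (c.trans e) c'
    ⟨hcx, hxe⟩ hcx' ?_ hc' fun u hu => ?_
  · refine (c.trans e).mem_maximalAtlas_of_contMDiffOn ?_ ?_
    · exact he.contMDiffOn.comp ((contMDiffOn_of_mem_maximalAtlas hc).mono inter_subset_left)
        fun y hy => hy.2
    · exact (contMDiffOn_symm_of_mem_maximalAtlas hc).comp
        (he'.contMDiffOn.mono inter_subset_left) fun y hy => hy.2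
  · replace hu : u ∈ (c.trans e).target := by simpa using hu
    exact hfe u hu.1

theorem isSubmersion_of_surjective_mfderiv [FiniteDimensional ℝ E] [FiniteDimensional ℝ E']
    {f : M → N} (hf : ContMDiff 𝓘(ℝ, E) 𝓘(ℝ, E') ∞ f)
    (hsurj : ∀ x, Function.Surjective (mfderiv 𝓘(ℝ, E) 𝓘(ℝ, E') f x)) :
    IsSubmersion 𝓘(ℝ, E) 𝓘(ℝ, E') ∞ f := by
  let F := ULift (EuclideanSpace ℝ (Fin (Module.finrank ℝ E - Module.finrank ℝ E')))
  exact ⟨F, inferInstance, inferInstance, fun x =>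
    isSubmersionAtOfComplement_of_surjective_mfderiv (by simp [F]) hf (hsurj x)⟩

end Submersion

/-! ### Orbits of linear actions -/

section Orbit

open Set Filter Topology Manifold MulAction

variable {G V E : Type} [TopologicalSpace G] [NormedAddCommGroup V] [NormedSpace ℝ V]
  [NormedAddCommGroup E] [NormedSpace ℝ E]

namespace IsEmbeddedStructure

variable {ι : G → V} {d : ℕ} {c : ChartedSpace (EuclideanSpace ℝ (Fin d)) G}
  {E' H' N : Type*} [NormedAddCommGroup E'] [NormedSpace ℝ E'] [TopologicalSpace H']
  {I' : ModelWithCorners ℝ E' H'} [TopologicalSpace N] [ChartedSpace H' N] {f : N → G}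

theorem contMDiffAt_of_comp (h : IsEmbeddedStructure ι d c) {x : N}
    (hf : ContMDiffAt I' 𝓘(ℝ, V) ∞ (ι ∘ f) x) : ContMDiffAt I' (𝓡 d) ∞ f x := by
  rw [ContMDiffAt.iff_comp_isImmersionAt (h.isSmoothEmbedding.isImmersion.isImmersionAt (f x))]
  exact ⟨h.isSmoothEmbedding.isEmbedding.continuousAt_iff.2 hf.continuousAt, hf⟩

theorem contMDiff_of_comp (h : IsEmbeddedStructure ι d c)
    (hf : ContMDiff I' 𝓘(ℝ, V) ∞ (ι ∘ f)) : ContMDiff I' (𝓡 d) ∞ f :=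
  fun x => h.contMDiffAt_of_comp (hf x)

end IsEmbeddedStructure

variable [Group G] {ι : G → V} {S : Set E} [MulAction G S] {F : V → E} {x₀ : S}

/-- `S` is the orbit of `x₀` under a linear action of `G` on `E`, where `G` is embedded in `V` by
`ι` so that left translations are linear. The orbit map of `x₀` is the restriction to `G` of the
smooth map `F`, and it has a smooth section on a neighbourhood of `x₀` in `E`. The section is a
map `σ` into `V` with values in the image of `G`, so that no smooth structure on `G` is needed. -/
structure IsLinearOrbit (ι : G → V) (S : Set E) [MulAction G S] (F : V → E) (x₀ : S) : Prop where
  isEmbedding : IsEmbedding ι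
  exists_leftMul : ∀ g, ∃ L : V →L[ℝ] V, ∀ h, ι (g * h) = L (ι h)
  contDiff : ContDiff ℝ ω F
  apply_eq : ∀ g, F (ι g) = (g • x₀ : S)
  isPretransitive : IsPretransitive G S
  exists_linearEquiv : ∀ g : G, ∃ T : E ≃L[ℝ] E, ∀ X : S, T X = (g • X : S)
  exists_section : ∃ σ : E → V, ContDiffAt ℝ ω σ x₀ ∧ σ x₀ = ι 1 ∧
    ∀ᶠ X in 𝓝 (x₀ : E), σ X ∈ range ι ∧ (X ∈ S → F (σ X) = X)

namespace IsLinearOrbit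

theorem exists_smul_base_eq (h : IsLinearOrbit ι S F x₀) (X : S) : ∃ g : G, g • x₀ = X :=
  have := h.isPretransitive
  exists_smul_eq G x₀ X

theorem exists_linearEquiv_mem_iff (h : IsLinearOrbit ι S F x₀) (g : G) :
    ∃ T : E ≃L[ℝ] E, (∀ X : S, T X = (g • X : S)) ∧ ∀ y, T y ∈ S ↔ y ∈ S := by
  obtain ⟨T, hT⟩ := h.exists_linearEquiv g
  refine ⟨T, hT, fun y => ⟨fun hy => ?_, fun hy => hT ⟨y, hy⟩ ▸ Subtype.coe_prop _⟩⟩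
  have hy' : y = (g⁻¹ • (⟨T y, hy⟩ : S) : S) :=
    T.injective (by rw [hT, smul_inv_smul])
  exact hy' ▸ Subtype.coe_prop _

theorem exists_section_at (h : IsLinearOrbit ι S F x₀) (g : G) :
    ∃ s : E → G, s (g • x₀ : S) = g ∧ ContDiffAt ℝ ω (ι ∘ s) (g • x₀ : S) ∧
      ∀ᶠ X in 𝓝 ((g • x₀ : S) : E), X ∈ S → (s X • x₀ : S) = X := by
  obtain ⟨σ, hσ, hσ1, hσS⟩ := h.exists_section
  obtain ⟨T, hT, hTS⟩ := h.exists_linearEquiv_mem_iff g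
  obtain ⟨L, hL⟩ := h.exists_leftMul g
  have hTx : T.symm (g • x₀ : S) = x₀ := by rw [← hT, T.symm_apply_apply]
  have hσι : ∀ X, σ X ∈ range ι → ι (Function.invFun ι (σ X)) = σ X :=
    fun X hX => Function.invFun_eq hX
  have hev : ∀ᶠ X in 𝓝 ((g • x₀ : S) : E),
      σ (T.symm X) ∈ range ι ∧ (T.symm X ∈ S → F (σ (T.symm X)) = T.symm X) :=
    T.symm.continuous.continuousAt.eventually (hTx.symm ▸ hσS)
  refine ⟨fun X => g * Function.invFun ι (σ (T.symm X)), ?_, ?_, ?_⟩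
  · simp only [hTx, hσ1, Function.leftInverse_invFun h.isEmbedding.injective 1, mul_one]
  · have hLσ : ContDiffAt ℝ ω (fun X => L (σ (T.symm X))) (g • x₀ : S) :=
      L.contDiff.contDiffAt.comp _
        (ContDiffAt.comp _ (hTx.symm ▸ hσ) T.symm.contDiff.contDiffAt)
    refine hLσ.congr_of_eventuallyEq (hev.mono fun X hX => ?_)
    exact (hL _).trans (congrArg L (hσι _ hX.1))
  · filter_upwards [hev] with X hX hXS
    have hXS' : T.symm X ∈ S := (hTS _).1 (by rwa [T.apply_symm_apply])
    rw [mul_smul, ← hT, ← h.apply_eq, hσι _ hX.1, hX.2 hXS', T.apply_symm_apply]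

theorem exists_isSmoothRetractionAt (h : IsLinearOrbit ι S F x₀) :
    ∃ r : E → E, IsSmoothRetractionAt S r x₀ := by
  obtain ⟨s, hs1, hs, hsS⟩ := h.exists_section_at 1
  rw [one_smul] at hs1 hs hsS
  refine ⟨fun X => F (ι (s X)), h.contDiff.contDiffAt.comp _ hs, ?_, .of_forall fun X => ?_, ?_⟩
  · rw [hs1, h.apply_eq, one_smul]
  · exact h.apply_eq _ ▸ Subtype.coe_prop _
  · filter_upwards [hsS] with X hX hXS
    rw [h.apply_eq, hX hXS]

theorem exists_isEmbeddedStructure [FiniteDimensional ℝ E] (h : IsLinearOrbit ι S F x₀)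
    {M : Type} [TopologicalSpace M] (Φ : M ≃ₜ S) :
    ∃ (d : ℕ) (c : ChartedSpace (EuclideanSpace ℝ (Fin d)) M),
      IsEmbeddedStructure (fun x => (Φ x : E)) d c := by
  have hrange : range (fun x => (Φ x : E)) = S := by
    rw [← Function.comp_def, Φ.surjective.range_comp, Subtype.range_val]
  obtain ⟨r, hr⟩ := h.exists_isSmoothRetractionAt
  refine exists_isEmbeddedStructure_of_retraction (x₀ := Φ.symm x₀) (r := r)
    (IsEmbedding.subtypeVal.comp Φ.isEmbedding) ?_ fun x => ?_
  · rwa [hrange, Φ.apply_symm_apply]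
  · obtain ⟨g, hg⟩ := h.exists_smul_base_eq (Φ x)
    obtain ⟨T, hT, hTS⟩ := h.exists_linearEquiv_mem_iff g⁻¹
    rw [hrange, Φ.apply_symm_apply]
    exact ⟨T, by rw [hT, inv_smul_eq_iff.2 hg.symm], hTS⟩

theorem continuous_smul_base (h : IsLinearOrbit ι S F x₀) : Continuous fun g : G => g • x₀ :=
  continuous_induced_rng.2 <|
    (h.contDiff.continuous.comp h.isEmbedding.continuous).congr h.apply_eq

theorem exists_homeomorph (h : IsLinearOrbit ι S F x₀) :
    ∃ Φ : (G ⧸ stabilizer G x₀) ≃ₜ S, ∀ q, Φ q = ofQuotientStabilizer G x₀ q := by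
  have hsurj : Function.Surjective (ofQuotientStabilizer G x₀) := fun X =>
    (h.exists_smul_base_eq X).imp' QuotientGroup.mk fun _ => id
  let e := Equiv.ofBijective _ ⟨injective_ofQuotientStabilizer G x₀, hsurj⟩
  refine ⟨⟨e, h.continuous_smul_base.quotient_lift _, ?_⟩, fun _ => rfl⟩
  refine continuous_iff_continuousAt.2 fun X => ?_
  obtain ⟨g, rfl⟩ := h.exists_smul_base_eq X
  obtain ⟨s, -, hs, hsS⟩ := h.exists_section_at g
  have hs' : ContinuousAt (fun Y : S => s Y) (g • x₀) :=
    h.isEmbedding.continuousAt_iff.2 <|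
      ContinuousAt.comp (f := Subtype.val) hs.continuousAt continuous_subtype_val.continuousAt
  refine (QuotientGroup.continuous_mk.continuousAt.comp hs').congr ?_
  filter_upwards [continuous_subtype_val.continuousAt.eventually hsS] with Y hY
  exact (e.symm_apply_eq.2 (Subtype.ext (hY Y.2).symm)).symm

variable {m : ℕ} {cG : ChartedSpace (EuclideanSpace ℝ (Fin m)) G}

theorem contMDiff_smul_base (h : IsLinearOrbit ι S F x₀) (hG : IsEmbeddedStructure ι m cG) :
    ContMDiff (𝓡 m) 𝓘(ℝ, E) ∞ fun g : G => ((g • x₀ : S) : E) :=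
  ((h.contDiff.of_le (by simp)).contMDiff.comp hG.isSmoothEmbedding.contMDiff).congr
    fun g => (h.apply_eq g).symm

theorem exists_section_contMDiffAt (h : IsLinearOrbit ι S F x₀) (hG : IsEmbeddedStructure ι m cG)
    {d : ℕ} {M : Type} [TopologicalSpace M] {c : ChartedSpace (EuclideanSpace ℝ (Fin d)) M}
    {Φ : M ≃ₜ S} (hc : IsEmbeddedStructure (fun x => (Φ x : E)) d c) (g : G) :
    ∃ s : M → G, s (Φ.symm (g • x₀)) = g ∧ ContMDiffAt (𝓡 d) (𝓡 m) ∞ s (Φ.symm (g • x₀)) ∧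
      ∀ᶠ x in 𝓝 (Φ.symm (g • x₀)), Φ.symm (s x • x₀) = x := by
  obtain ⟨s, hsg, hs, hsS⟩ := h.exists_section_at g
  have hΦ : (Φ (Φ.symm (g • x₀)) : E) = (g • x₀ : S) := by rw [Φ.apply_symm_apply]
  rw [← hΦ] at hs hsS
  refine ⟨fun x => s (Φ x), by simp only [hΦ, hsg], hG.contMDiffAt_of_comp ?_, ?_⟩
  · exact ContMDiffAt.comp (f := fun x => (Φ x : E)) _ (hs.of_le (by simp)).contMDiffAt
      hc.isSmoothEmbedding.contMDiff.contMDiffAt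
  · filter_upwards [hc.isSmoothEmbedding.contMDiff.continuous.continuousAt.eventually hsS]
      with x hx
    exact Φ.symm_apply_eq.2 (Subtype.ext (hx (Φ x).2))

theorem exists_isHomogeneousStructure [FiniteDimensional ℝ E] (h : IsLinearOrbit ι S F x₀)
    (hG : IsEmbeddedStructure ι m cG) :
    ∃ (d : ℕ) (c : ChartedSpace (EuclideanSpace ℝ (Fin d)) (G ⧸ stabilizer G x₀)),
      IsHomogeneousStructure m cG (stabilizer G x₀) d c := by
  obtain ⟨Φ, hΦ⟩ := h.exists_homeomorph
  obtain ⟨d, c, hc⟩ := h.exists_isEmbeddedStructure Φ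
  have := hG.isManifold
  have := hc.isManifold
  have hΦmk : ∀ g : G, Φ.symm (g • x₀) = g := fun g => Φ.symm_apply_eq.2 (hΦ g).symm
  have hmk : ContMDiff (𝓡 m) (𝓡 d) ∞ (QuotientGroup.mk : G → G ⧸ stabilizer G x₀) :=
    hc.contMDiff_of_comp ((h.contMDiff_smul_base hG).congr fun g =>
      congrArg Subtype.val (hΦ g))
  refine ⟨d, c, hc.isManifold, isSubmersion_of_surjective_mfderiv hmk fun g => ?_⟩
  obtain ⟨s, hsg, hs, hΦs⟩ := h.exists_section_contMDiffAt hG hc g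
  simp only [hΦmk] at hsg hs hΦs
  have := surjective_mfderiv_of_section ((hmk _).mdifferentiableAt (by simp))
    (hs.mdifferentiableAt (by simp)) hΦs
  rwa [hsg] at this

theorem exists_diffeomorph (h : IsLinearOrbit ι S F x₀)
    {d d' : ℕ} {cS : ChartedSpace (EuclideanSpace ℝ (Fin d)) S}
    {cQ : ChartedSpace (EuclideanSpace ℝ (Fin d')) (G ⧸ stabilizer G x₀)}
    (hG : IsEmbeddedStructure ι m cG) (hS : IsEmbeddedStructure (Subtype.val : S → E) d cS)
    (hQ : IsHomogeneousStructure m cG (stabilizer G x₀) d' cQ) :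
    ∃ φ : S ≃ₘ^∞⟮𝓡 d, 𝓡 d'⟯ (G ⧸ stabilizer G x₀),
      (∀ (g : G) (X : S), φ (g • X) = g • φ X) ∧
      ∀ g : G, (φ.symm (g : G ⧸ stabilizer G x₀) : E) = F (ι g) := by
  obtain ⟨Φ, hΦ⟩ := h.exists_homeomorph
  have hΦmk : ∀ g : G, Φ.symm (g • x₀) = g := fun g => Φ.symm_apply_eq.2 (hΦ g).symm
  have hinv : ContMDiff (𝓡 d') (𝓡 d) ∞ Φ :=
    contMDiff_of_comp_isSubmersion hQ.isSubmersion QuotientGroup.mk_surjective <|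
      hS.contMDiff_of_comp <| (h.contMDiff_smul_base hG).congr fun g =>
        congrArg Subtype.val (hΦ g)
  have hfwd : ContMDiff (𝓡 d) (𝓡 d') ∞ Φ.symm := by
    intro X
    obtain ⟨g, rfl⟩ := h.exists_smul_base_eq X
    obtain ⟨s, -, hs, hsS⟩ := h.exists_section_contMDiffAt hG (Φ := .refl S) hS g
    refine (hQ.isSubmersion.contMDiff.contMDiffAt.comp _ hs).congr_of_eventuallyEq ?_
    exact hsS.mono fun Y hY => (congrArg Φ.symm hY).symm.trans (hΦmk _)
  refine ⟨⟨Φ.symm.toEquiv, hfwd, hinv⟩, fun g X => ?_, fun g => ?_⟩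
  · refine Φ.symm_apply_eq.2 ?_
    rw [hΦ, ofQuotientStabilizer_smul, ← hΦ]
    exact congrArg (g • ·) (Φ.apply_symm_apply X).symm
  · exact (congrArg Subtype.val (hΦ g)).trans (h.apply_eq g).symm

theorem isEquivariantModel [FiniteDimensional ℝ E] {n : ℕ} {S : Set E}
    [MulAction (CompactSp n) S] {F : QMat n n → E} {x₀ : S}
    (h : IsLinearOrbit (Subtype.val : CompactSp n → QMat n n) S F x₀)
    {H : Subgroup (CompactSp n)} (hH : stabilizer (CompactSp n) x₀ = H) :
    IsEquivariantModel S H fun Q => F Q := by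
  subst hH
  exact
    { exists_embedded := h.exists_isEmbeddedStructure (.refl S)
      exists_homogeneous := fun _ _ hG => h.exists_isHomogeneousStructure hG
      exists_diffeomorph := fun _ _ _ _ _ _ hG hS hQ => h.exists_diffeomorph hG hS hQ }

end IsLinearOrbit

end Orbit

/-! ### The unitary polar factor near the identity -/

instance : StarModule ℝ ℍ[ℝ] := ⟨Quaternion.star_smul⟩

section MatrixCalculus

open Filter Topology

variable {X R l m n : Type*} [NormedAddCommGroup X] [NormedSpace ℝ X] [NormedRing R]
  [NormedAlgebra ℝ R] [Fintype l] [Fintype m] [Fintype n] {r : ℕ∞ω} {x : X}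

theorem contDiffAt_matrix_mul {f : X → Matrix l m R} {g : X → Matrix m n R}
    (hf : ContDiffAt ℝ r f x) (hg : ContDiffAt ℝ r g x) :
    ContDiffAt ℝ r (fun y => f y * g y) x := by
  refine contDiffAt_pi.2 fun i => contDiffAt_pi.2 fun j => ?_
  simp only [Matrix.mul_apply]
  exact ContDiffAt.sum fun k _ => (contDiffAt_pi.1 (contDiffAt_pi.1 hf i) k).mul
    (contDiffAt_pi.1 (contDiffAt_pi.1 hg k) j)

theorem contDiffAt_matrix_conjTranspose [StarRing R] [StarModule ℝ R] [ContinuousStar R]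
    {f : X → Matrix l m R} (hf : ContDiffAt ℝ r f x) : ContDiffAt ℝ r (fun y => (f y)ᴴ) x :=
  contDiffAt_pi.2 fun i => contDiffAt_pi.2 fun j =>
    (starL' ℝ : R ≃L[ℝ] R).contDiff.contDiffAt.comp x (contDiffAt_pi.1 (contDiffAt_pi.1 hf j) i)

end MatrixCalculus

section UnitalProduct

open Filter Topology

/- The entrywise sup norm on matrices is not submultiplicative, so the inverse and the square root
are constructed for a bounded bilinear product instead of a normed ring. -/
variable {V : Type*} [NormedAddCommGroup V] [NormedSpace ℝ V] [CompleteSpace V]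
  (B : V →L[ℝ] V →L[ℝ] V) {e : V}

theorem exists_contDiffAt_inverse (hl : ∀ v, B e v = v) :
    ∃ inv : V → V, ContDiffAt ℝ ω inv e ∧ inv e = e ∧ ∀ᶠ x in 𝓝 e, B x (inv x) = e := by
  have hB : B e = 1 := ContinuousLinearMap.ext hl
  refine ⟨fun x => Ring.inverse (B x) e, ?_, by simp [hB], ?_⟩
  · have hinv : ContDiffAt ℝ ω (Ring.inverse : (V →L[ℝ] V) → V →L[ℝ] V) (B e) :=
      hB ▸ contDiffAt_ringInverse ℝ 1
    exact (hinv.comp e B.contDiff.contDiffAt).clm_apply contDiffAt_const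
  · filter_upwards [B.continuous.continuousAt.eventually
      (Units.isOpen.mem_nhds (hB ▸ isUnit_one : IsUnit (B e)))] with x hx
    exact DFunLike.congr_fun (Ring.mul_inverse_cancel _ hx) e

theorem exists_contDiffAt_sqrt (hl : ∀ v, B e v = v) (hr : ∀ v, B v e = v) :
    ∃ sqrt : V → V,
      ContDiffAt ℝ ω sqrt e ∧ sqrt e = e ∧ ∀ᶠ x in 𝓝 e, B (sqrt x) (sqrt x) = x := by
  have hf : ContDiffAt ℝ ω (fun y => B y y) e := (B.contDiff.clm_apply contDiff_id).contDiffAt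
  let A : V ≃L[ℝ] V := ContinuousLinearEquiv.smulLeft (Units.mk0 (2 : ℝ) two_ne_zero)
  have hf' : HasFDerivAt (fun y => B y y) (A : V →L[ℝ] V) e := by
    refine ((B.hasFDerivAt (x := e)).clm_apply (hasFDerivAt_id e)).congr_fderiv ?_
    refine ContinuousLinearMap.ext fun v => ?_
    change B e v + B v e = (2 : ℝ) • v
    rw [hl, hr, two_smul]
  have hsmooth := hf.to_localInverse hf' (by simp)
  have hself := hf.localInverse_apply_image hf' (by simp)
  have hright := (hf.hasStrictFDerivAt' hf' (by simp)).eventually_right_inverse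
  rw [hl] at hsmooth hself hright
  exact ⟨_, hsmooth, hself, hright⟩

theorem eventually_eq_zero_of_add_eq_zero (hl : ∀ v, B e v = v) (hr : ∀ v, B v e = v) :
    ∀ᶠ p : V × V in 𝓝 (e, e), ∀ t, B p.1 t + B t p.2 = 0 → t = 0 := by
  let sylvester (p : V × V) : V →L[ℝ] V := B p.1 + B.flip p.2
  have hcont : Continuous sylvester :=
    (B.continuous.comp continuous_fst).add (B.flip.continuous.comp continuous_snd)
  have hunit : IsUnit (sylvester (e, e)) := by
    have : sylvester (e, e) = (2 : ℝ) • 1 :=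
      ContinuousLinearMap.ext fun v => by simp [sylvester, hl, hr, two_smul]
    exact this ▸ isUnit_one.smul (Units.mk0 (2 : ℝ) two_ne_zero)
  filter_upwards [hcont.continuousAt.eventually (Units.isOpen.mem_nhds hunit)] with p hp t ht
  obtain ⟨u, hu⟩ := hp
  have huu : (↑u⁻¹ : V →L[ℝ] V) ((u : V →L[ℝ] V) t) = t := DFunLike.congr_fun u.inv_mul t
  have hut : (u : V →L[ℝ] V) t = 0 := hu ▸ ht
  rw [← huu, hut, map_zero]

end UnitalProduct

section Polar

open Filter Topology Matrix

variable {R ι : Type*} [NormedRing R] [NormedAlgebra ℝ R] [FiniteDimensional ℝ R] [Fintype ι]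

variable (R ι) in
theorem exists_continuousLinearMap_matrix_mul :
    ∃ B : Matrix ι ι R →L[ℝ] Matrix ι ι R →L[ℝ] Matrix ι ι R, ∀ X Y, B X Y = X * Y :=
  ⟨LinearMap.toContinuousLinearMap
    (LinearMap.toContinuousLinearMap.toLinearMap ∘ₗ LinearMap.mk₂ ℝ (· * ·) Matrix.add_mul
      Matrix.smul_mul Matrix.mul_add fun r X Y => Matrix.mul_smul X r Y),
    fun _ _ => rfl⟩

variable [DecidableEq ι]

theorem matrix_mul_eq_one_symm {X Y : Matrix ι ι R} (h : X * Y = 1) : Y * X = 1 :=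
  have : IsNoetherianRing (Matrix ι ι R) := isNoetherian_of_tower ℝ inferInstance
  mul_eq_one_symm h

variable (R ι) in
theorem exists_contDiffAt_inv_sqrt :
    ∃ ρ : Matrix ι ι R → Matrix ι ι R, ContDiffAt ℝ ω ρ 1 ∧ ρ 1 = 1 ∧
      ∀ᶠ X in 𝓝 1, X * (ρ X * ρ X) = 1 := by
  have : CompleteSpace (Matrix ι ι R) := FiniteDimensional.complete ℝ _
  obtain ⟨B, hB⟩ := exists_continuousLinearMap_matrix_mul R ι
  have hl (X) : B 1 X = X := (hB 1 X).trans (one_mul X)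
  have hr (X) : B X 1 = X := (hB X 1).trans (mul_one X)
  obtain ⟨inv, hinv, hinv1, hinv_eq⟩ := exists_contDiffAt_inverse B hl
  obtain ⟨sqrt, hsqrt, hsqrt1, hsqrt_eq⟩ := exists_contDiffAt_sqrt B hl hr
  refine ⟨sqrt ∘ inv, ContDiffAt.comp 1 (by rwa [hinv1]) hinv, by simp [hinv1, hsqrt1], ?_⟩
  filter_upwards [hinv_eq, hinv.continuousAt.eventually (by rwa [hinv1])] with X hX hX'
  calc X * (sqrt (inv X) * sqrt (inv X)) = X * inv X :=
        congrArg (X * ·) ((hB _ _).symm.trans hX')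
    _ = 1 := (hB _ _).symm.trans hX

variable (R ι) in
theorem eventually_intertwines_of_sq :
    ∀ᶠ p : Matrix ι ι R × Matrix ι ι R in 𝓝 (1, 1),
      ∀ T, p.1 * p.1 * T = T * (p.2 * p.2) → p.1 * T = T * p.2 := by
  have : CompleteSpace (Matrix ι ι R) := FiniteDimensional.complete ℝ _
  obtain ⟨B, hB⟩ := exists_continuousLinearMap_matrix_mul R ι
  have hl (X) : B 1 X = X := (hB 1 X).trans (one_mul X)
  have hr (X) : B X 1 = X := (hB X 1).trans (mul_one X)
  filter_upwards [eventually_eq_zero_of_add_eq_zero B hl hr] with p hp T hT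
  refine sub_eq_zero.1 (hp _ ?_)
  calc B p.1 (p.1 * T - T * p.2) + B (p.1 * T - T * p.2) p.2
      = p.1 * (p.1 * T - T * p.2) + (p.1 * T - T * p.2) * p.2 := congrArg₂ _ (hB _ _) (hB _ _)
    _ = p.1 * p.1 * T - T * (p.2 * p.2) := by noncomm_ring
    _ = 0 := sub_eq_zero.2 hT

variable [StarRing R] [StarModule ℝ R] [ContinuousStar R]

variable (R ι) in
theorem exists_hermitian_inv_sqrt :
    ∃ ρ : Matrix ι ι R → Matrix ι ι R, ContDiffAt ℝ ω ρ 1 ∧ ρ 1 = 1 ∧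
      ∀ᶠ X in 𝓝 1, ρ X * ρ X * X = 1 ∧ (Xᴴ = X → (ρ X)ᴴ = ρ X) ∧
        (∀ T, Commute X T → Commute (ρ X) T) ∧ ∀ T, X * T = T → ρ X * T = T := by
  obtain ⟨ρ, hρ, hρ1, hρ_eq⟩ := exists_contDiffAt_inv_sqrt R ι
  have hsylv := eventually_intertwines_of_sq R ι
  have tendsto_ρ : Tendsto ρ (𝓝 1) (𝓝 1) := by
    have := hρ.continuousAt
    rwa [ContinuousAt, hρ1] at this
  have tendsto_adj : Tendsto (fun X => (ρ X)ᴴ) (𝓝 1) (𝓝 1) := by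
    have := (contDiffAt_matrix_conjTranspose hρ).continuousAt
    rwa [ContinuousAt, hρ1, conjTranspose_one] at this
  have h_self : ∀ᶠ X in 𝓝 1, ∀ T, ρ X * ρ X * T = T * (ρ X * ρ X) → ρ X * T = T * ρ X :=
    (tendsto_ρ.prodMk_nhds tendsto_ρ).eventually hsylv
  have h_adj : ∀ᶠ X in 𝓝 1, ∀ T,
      (ρ X)ᴴ * (ρ X)ᴴ * T = T * (ρ X * ρ X) → (ρ X)ᴴ * T = T * ρ X :=
    (tendsto_adj.prodMk_nhds tendsto_ρ).eventually hsylv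
  have h_one : ∀ᶠ X in 𝓝 1, ∀ T, ρ X * ρ X * T = T * (1 * 1) → ρ X * T = T * 1 :=
    (tendsto_ρ.prodMk_nhds tendsto_const_nhds).eventually hsylv
  refine ⟨ρ, hρ, hρ1, ?_⟩
  filter_upwards [hρ_eq, h_self, h_adj, h_one] with X hX h_self h_adj h_one
  have hX' : ρ X * ρ X * X = 1 := matrix_mul_eq_one_symm hX
  refine ⟨hX', fun hXX => ?_, fun T hT => h_self T ?_, fun T hT => ?_⟩
  · have hadj : (ρ X)ᴴ * (ρ X)ᴴ = ρ X * ρ X := by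
      have : (ρ X)ᴴ * (ρ X)ᴴ * X = 1 := by
        nth_rw 3 [← hXX]
        rw [← conjTranspose_mul, ← conjTranspose_mul, hX, conjTranspose_one]
      exact left_inv_eq_right_inv this hX
    simpa using h_adj 1 (by simpa using hadj)
  · calc ρ X * ρ X * T = ρ X * ρ X * (T * X) * (ρ X * ρ X) := by
          rw [mul_assoc _ (T * X), mul_assoc T, hX, mul_one]
      _ = ρ X * ρ X * X * T * (ρ X * ρ X) := by rw [← hT.eq]; noncomm_ring
      _ = T * (ρ X * ρ X) := by rw [hX', one_mul]
  · have hT' : ρ X * ρ X * T = T := by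
      calc ρ X * ρ X * T = ρ X * ρ X * X * T := by rw [mul_assoc _ X, hT]
        _ = T := by rw [hX', one_mul]
    simpa using h_one T (by simpa using hT')

variable (R ι) in
theorem exists_contDiffAt_polar :
    ∃ pol : Matrix ι ι R → Matrix ι ι R, ContDiffAt ℝ ω pol 1 ∧ pol 1 = 1 ∧
      ∀ᶠ W in 𝓝 1, pol W ∈ unitary (Matrix ι ι R) ∧
        (∀ X T, Commute (Wᴴ * W) T → X * W = W * T → X * pol W = pol W * T) ∧
        ∀ T, Wᴴ * W * T = T → pol W * T = W * T := by
  obtain ⟨ρ, hρ, hρ1, hρ_prop⟩ := exists_hermitian_inv_sqrt R ι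
  have hgram : ContDiffAt ℝ ω (fun W : Matrix ι ι R => Wᴴ * W) 1 :=
    contDiffAt_matrix_mul (contDiffAt_matrix_conjTranspose contDiffAt_id) contDiffAt_id
  have hgram1 : (1 : Matrix ι ι R)ᴴ * 1 = 1 := by simp
  have tendsto_gram : Tendsto (fun W : Matrix ι ι R => Wᴴ * W) (𝓝 1) (𝓝 1) := by
    have := hgram.continuousAt
    rwa [ContinuousAt, hgram1] at this
  refine ⟨fun W => W * ρ (Wᴴ * W), ?_, ?_, ?_⟩
  · exact contDiffAt_matrix_mul contDiffAt_id
      (ContDiffAt.comp (g := ρ) 1 (by rwa [hgram1]) hgram)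
  · simp only [hgram1, hρ1, mul_one]
  filter_upwards [tendsto_gram.eventually hρ_prop] with W ⟨hsq, hherm, hcomm, hfix⟩
  replace hherm : (ρ (Wᴴ * W))ᴴ = ρ (Wᴴ * W) := hherm (by simp)
  refine ⟨?_, fun X T hT hX => ?_, fun T hT => ?_⟩
  · have hunit : (W * ρ (Wᴴ * W))ᴴ * (W * ρ (Wᴴ * W)) = 1 := by
      calc (W * ρ (Wᴴ * W))ᴴ * (W * ρ (Wᴴ * W))
          = ρ (Wᴴ * W) * ((Wᴴ * W) * ρ (Wᴴ * W)) := by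
            rw [conjTranspose_mul, hherm]; noncomm_ring
        _ = 1 := by rw [← (hcomm _ (Commute.refl _)).eq, ← mul_assoc, hsq]
    exact Unitary.mem_iff.2 ⟨hunit, matrix_mul_eq_one_symm hunit⟩
  · rw [← mul_assoc, hX, mul_assoc, mul_assoc, (hcomm T hT).eq]
  · rw [mul_assoc, hfix T hT]

end Polar

/-! ### The compact symplectic group -/

section CompactSymplectic

open Filter Topology Matrix

/-- Left multiplication by an element of `Sp(n)`, as a linear automorphism of `ℍ^{n × k}`. -/
noncomputable def mulLeftEquiv {n : ℕ} (Q : CompactSp n) (k : ℕ) : QMat n k ≃L[ℝ] QMat n k :=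
  (LinearEquiv.ofLinearMap (mulLeftLinearMap (Fin k) ℝ (Q : QMat n n))
    (mulLeftLinearMap (Fin k) ℝ (star Q : QMat n n))
    (by rw [← mulLeftLinearMap_mul, Unitary.mul_star_self_of_mem Q.2, mulLeftLinearMap_one])
    (by rw [← mulLeftLinearMap_mul, Unitary.star_mul_self_of_mem Q.2,
      mulLeftLinearMap_one])).toContinuousLinearEquiv

theorem exists_isEmbeddedStructure_compactSp (n : ℕ) :
    ∃ (m : ℕ) (cG : ChartedSpace (EuclideanSpace ℝ (Fin m)) (CompactSp n)),
      IsEmbeddedStructure (Subtype.val : CompactSp n → QMat n n) m cG := by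
  obtain ⟨pol, hpol, hpol1, hpol_prop⟩ := exists_contDiffAt_polar ℍ[ℝ] (Fin n)
  refine exists_isEmbeddedStructure_of_retraction (x₀ := 1) (r := pol) .subtypeVal ?_ fun Q => ?_
  · rw [Subtype.range_val]
    refine ⟨hpol, hpol1, hpol_prop.mono fun W hW => hW.1, hpol_prop.mono fun W hW hWu => ?_⟩
    simpa using hW.2.2 1 (by rw [mem_compactSp_iff.1 hWu, mul_one])
  · refine ⟨mulLeftEquiv Q⁻¹ n, congrArg Subtype.val (inv_mul_cancel Q), fun Y => ⟨?_, ?_⟩⟩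
    · rintro ⟨P, hP : (P : QMat n n) = (Q⁻¹ : CompactSp n) * Y⟩
      refine ⟨Q * P, ?_⟩
      rw [Submonoid.coe_mul, hP, ← mul_assoc, ← Submonoid.coe_mul, mul_inv_cancel,
        Submonoid.coe_one, one_mul]
    · rintro ⟨P, rfl⟩
      exact ⟨Q⁻¹ * P, rfl⟩

end CompactSymplectic

/-! ### Block-diagonal elements of `Sp(n)` -/

section BlockDiagonal

open Matrix

theorem twoBlock_injective {n k : ℕ} (hk : k ≤ n) {A A' : QMat k k} {B B' : QMat (n - k) (n - k)}
    (h : twoBlock hk A B = twoBlock hk A' B') : A = A' ∧ B = B' := by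
  obtain ⟨hA, -, -, hB⟩ := fromBlocks_inj.1 ((reindex _ _).injective h)
  exact ⟨hA, hB⟩

theorem twoBlock_apply {n k : ℕ} (hk : k ≤ n) (A : QMat k k) (B : QMat (n - k) (n - k))
    (x y : Fin k ⊕ Fin (n - k)) :
    twoBlock hk A B (twoBlockEquiv hk x) (twoBlockEquiv hk y) = fromBlocks A 0 0 B x y := by
  simp [twoBlock]

theorem twoBlockEquiv_inl {n k : ℕ} (hk : k ≤ n) (i : Fin k) :
    twoBlockEquiv hk (Sum.inl i) = Fin.castLE hk i := by
  ext; simp [twoBlockEquiv]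

theorem exists_twoBlock_eq {n k : ℕ} (hk : k ≤ n) {M : QMat n n}
    (h₁₂ : ∀ i j, M (twoBlockEquiv hk (.inl i)) (twoBlockEquiv hk (.inr j)) = 0)
    (h₂₁ : ∀ i j, M (twoBlockEquiv hk (.inr i)) (twoBlockEquiv hk (.inl j)) = 0) :
    ∃ A B, twoBlock hk A B = M := by
  let R := M.submatrix (twoBlockEquiv hk) (twoBlockEquiv hk)
  refine ⟨R.toBlocks₁₁, R.toBlocks₂₂, ?_⟩
  have hR : fromBlocks R.toBlocks₁₁ 0 0 R.toBlocks₂₂ = R := by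
    rw [← show R.toBlocks₁₂ = 0 from Matrix.ext h₁₂, ← show R.toBlocks₂₁ = 0 from Matrix.ext h₂₁,
      fromBlocks_toBlocks]
  rw [twoBlock, hR]
  exact (reindex (twoBlockEquiv hk) (twoBlockEquiv hk)).apply_symm_apply M

theorem exists_twoBlockHom_eq {n k : ℕ} (hk : k ≤ n) {Q : CompactSp n} {A : QMat k k}
    {B : QMat (n - k) (n - k)} (hQ : twoBlock hk A B = Q) :
    ∃ W, twoBlockHom hk W = Q ∧ W.1 = A ∧ W.2 = B := by
  have hu := mem_compactSp_iff.1 Q.2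
  rw [← hQ, twoBlock_conjTranspose, ← twoBlock_mul, ← twoBlock_one hk] at hu
  obtain ⟨hA, hB⟩ := twoBlock_injective hk hu
  exact ⟨(⟨A, mem_compactSp_iff.2 hA⟩, ⟨B, mem_compactSp_iff.2 hB⟩), Subtype.ext hQ, rfl, rfl⟩

theorem flagBlock_apply {n p : ℕ} {k : Fin p → ℕ} (hk : StrictMono k) (hn : ∀ j, k j < n)
    (M : ∀ j, QMat (flagSize n k j) (flagSize n k j)) (x y : Σ j, Fin (flagSize n k j)) :
    flagBlock hk hn M (flagEquiv hk hn x) (flagEquiv hk hn y) = blockDiagonal' M x y := by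
  simp [flagBlock]

theorem exists_flagBlock_eq {n p : ℕ} {k : Fin p → ℕ} (hk : StrictMono k) (hn : ∀ j, k j < n)
    {M : QMat n n} (h : ∀ x y, x.1 ≠ y.1 → M (flagEquiv hk hn x) (flagEquiv hk hn y) = 0) :
    ∃ N, flagBlock hk hn N = M := by
  let R := M.submatrix (flagEquiv hk hn) (flagEquiv hk hn)
  refine ⟨R.blockDiag', ?_⟩
  have hR : blockDiagonal' R.blockDiag' = R := by
    ext ⟨x₁, x₂⟩ ⟨y₁, y₂⟩ : 1
    by_cases hxy : x₁ = y₁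
    · subst hxy
      rw [blockDiagonal'_apply_eq, blockDiag'_apply]
    · rw [blockDiagonal'_apply_ne _ _ _ hxy]
      exact (h ⟨x₁, x₂⟩ ⟨y₁, y₂⟩ hxy).symm
  rw [flagBlock, hR]
  exact (reindex (flagEquiv hk hn) (flagEquiv hk hn)).apply_symm_apply M

theorem exists_flagBlockHom_eq {n p : ℕ} {k : Fin p → ℕ} (hk : StrictMono k) (hn : ∀ j, k j < n)
    {Q : CompactSp n} {N : ∀ j, QMat (flagSize n k j) (flagSize n k j)}
    (hQ : flagBlock hk hn N = Q) : ∃ W, flagBlockHom hk hn W = Q := by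
  have hu := mem_compactSp_iff.1 Q.2
  rw [← hQ, flagBlock_conjTranspose, ← flagBlock_mul, ← flagBlock_one hk hn] at hu
  have hN := blockDiagonal'_injective ((reindex _ _).injective hu)
  exact ⟨fun j => ⟨N j, mem_compactSp_iff.2 (congrFun hN j)⟩, Subtype.ext hQ⟩

end BlockDiagonal

/-! ### The Stiefel manifold -/

section Stiefel

open Filter Topology Matrix

/-- The base point of the Stiefel manifold: the first `k` columns of the identity matrix. -/
noncomputable def stiefelBase {n k : ℕ} (hk : k ≤ n) : QMat n k :=
  (1 : QMat n n).submatrix id (Fin.castLE hk)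

theorem mul_stiefelBase {n k : ℕ} (hk : k ≤ n) (Q : QMat n n) :
    Q * stiefelBase hk = Q.submatrix id (Fin.castLE hk) := by
  rw [stiefelBase, ← submatrix_id_id Q, ← submatrix_mul _ _ _ _ _ Function.bijective_id,
    Matrix.mul_one, submatrix_submatrix]
  rfl

theorem stiefelBase_mem {n k : ℕ} (hk : k ≤ n) : stiefelBase hk ∈ quatStiefel n k := by
  change (stiefelBase hk)ᴴ * stiefelBase hk = 1
  rw [stiefelBase, conjTranspose_submatrix, conjTranspose_one,
    ← submatrix_mul _ _ _ _ _ Function.bijective_id, Matrix.one_mul,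
    submatrix_one _ (Fin.castLE_injective hk)]

theorem conjTranspose_mul_self_column {n : ℕ} (v : QMat n 1) :
    vᴴ * v = (∑ i, Quaternion.normSq (v i 0)) • 1 := by
  ext i j : 1
  rw [Subsingleton.elim i 0, Subsingleton.elim j 0, Matrix.smul_apply, one_apply_eq, mul_apply,
    Finset.sum_smul]
  refine Finset.sum_congr rfl fun l _ => ?_
  rw [conjTranspose_apply, Quaternion.star_mul_self, ← Algebra.algebraMap_eq_smul_one]
  rfl

theorem exists_conjTranspose_mul_self_smul_eq_one {n : ℕ} {v : QMat n 1} (hv : v ≠ 0) :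
    ∃ a : ℝ, (a • v)ᴴ * (a • v) = 1 := by
  set r : ℝ := ∑ i, Quaternion.normSq (v i 0)
  have hr : 0 < r := by
    obtain ⟨i, hi⟩ : ∃ i, v i 0 ≠ 0 := by
      by_contra! h
      exact hv (Matrix.ext fun i j => by rw [Subsingleton.elim j 0, h, Matrix.zero_apply])
    exact Finset.sum_pos' (fun _ _ => Quaternion.normSq_nonneg)
      ⟨i, Finset.mem_univ i, Quaternion.normSq_nonneg.lt_of_ne' (Quaternion.normSq_ne_zero.2 hi)⟩
  refine ⟨(√r)⁻¹, ?_⟩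
  rw [conjTranspose_smul, star_trivial, Matrix.smul_mul, Matrix.mul_smul,
    conjTranspose_mul_self_column, smul_smul, smul_smul, ← mul_inv, Real.mul_self_sqrt hr.le,
    inv_mul_cancel₀ hr.ne', one_smul]

theorem exists_orthonormal_column {n k : ℕ} (hk : k < n) (X : QMat n k) :
    ∃ w : QMat n 1, Xᴴ * w = 0 ∧ wᴴ * w = 1 := by
  have hker : (mulLeftLinearMap (Fin 1) ℝ Xᴴ).ker ≠ ⊥ :=
    LinearMap.ker_ne_bot_of_finrank_lt
      (by simpa [Module.finrank_matrix, Quaternion.finrank_eq_four] using hk)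
  obtain ⟨v, hv, hv0⟩ := Submodule.exists_mem_ne_zero_of_ne_bot hker
  obtain ⟨a, ha⟩ := exists_conjTranspose_mul_self_smul_eq_one hv0
  exact ⟨a • v, by rw [Matrix.mul_smul, show Xᴴ * v = 0 from hv, smul_zero], ha⟩

theorem exists_mul_stiefelBase_eq {n k : ℕ} (hk : k ≤ n) :
    ∀ X ∈ quatStiefel n k, ∃ Q : CompactSp n, (Q : QMat n n) * stiefelBase hk = X := by
  induction hk using Nat.decreasingInduction with
  | self => exact fun X hX => ⟨⟨X, mem_compactSp_iff.2 hX⟩, mul_stiefelBase le_rfl X⟩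
  | of_succ k hk ih =>
    intro X hX
    obtain ⟨w, hXw, hw⟩ := exists_orthonormal_column hk X
    have hwX : wᴴ * X = 0 := by
      rw [← conjTranspose_conjTranspose X, ← conjTranspose_mul, hXw, conjTranspose_zero]
    have hXw1 : (fromCols X w)ᴴ * fromCols X w = 1 := by
      rw [conjTranspose_fromCols_eq_fromRows_conjTranspose, fromRows_mul_fromCols, hXw, hwX, hw,
        show Xᴴ * X = 1 from hX, fromBlocks_one]
    obtain ⟨Q, hQ⟩ := ih ((fromCols X w).submatrix id finSumFinEquiv.symm) <| by
      change _ᴴ * _ = (1 : QMat _ _)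
      rw [conjTranspose_submatrix, ← submatrix_mul _ _ _ _ _ Function.bijective_id, hXw1,
        submatrix_one_equiv]
    refine ⟨Q, ?_⟩
    rw [mul_stiefelBase] at hQ ⊢
    calc (Q : QMat n n).submatrix id (Fin.castLE hk.le)
        = ((Q : QMat n n).submatrix id (Fin.castLE hk)).submatrix id (Fin.castAdd 1) := rfl
      _ = X := by
        rw [hQ]
        ext i j : 1
        simp

theorem mul_stiefelBase_eq_self_iff {n k : ℕ} (hk : k ≤ n) {M : QMat n n} :
    M * stiefelBase hk = stiefelBase hk ↔
      ∀ x i, M x (twoBlockEquiv hk (.inl i)) = (1 : QMat n n) x (twoBlockEquiv hk (.inl i)) := by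
  rw [mul_stiefelBase, stiefelBase, ← Matrix.ext_iff]
  simp only [submatrix_apply, id, twoBlockEquiv_inl]
  exact Iff.rfl

theorem twoBlock_mul_stiefelBase_eq_iff {n k : ℕ} (hk : k ≤ n) {A : QMat k k}
    {B : QMat (n - k) (n - k)} : twoBlock hk A B * stiefelBase hk = stiefelBase hk ↔ A = 1 := by
  rw [mul_stiefelBase_eq_self_iff, ← twoBlock_one hk, (twoBlockEquiv hk).surjective.forall,
    ← Matrix.ext_iff]
  simp [twoBlock_apply, Matrix.one_apply]

theorem mul_stiefelBase_eq_iff_mem {n k : ℕ} (hk : k ≤ n) {Q : CompactSp n} :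
    (Q : QMat n n) * stiefelBase hk = stiefelBase hk ↔ Q ∈ stiefelSubgroup hk := by
  refine ⟨fun h => ?_, ?_⟩
  · have h' : (Q : QMat n n)ᴴ * stiefelBase hk = stiefelBase hk := by
      nth_rw 1 [← h]
      rw [← Matrix.mul_assoc, mem_compactSp_iff.1 Q.2, Matrix.one_mul]
    obtain ⟨A, B, hAB⟩ := exists_twoBlock_eq hk (M := Q)
      (fun i j => star_eq_zero.1 <|
        ((mul_stiefelBase_eq_self_iff hk).1 h' (twoBlockEquiv hk (.inr j)) i).trans (by simp))
      (fun i j => ((mul_stiefelBase_eq_self_iff hk).1 h _ j).trans (by simp))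
    obtain ⟨⟨U, W⟩, hUW, rfl, -⟩ := exists_twoBlockHom_eq hk hAB
    rw [← hAB, twoBlock_mul_stiefelBase_eq_iff] at h
    obtain rfl : U = 1 := Subtype.ext h
    exact ⟨W, hUW⟩
  · rintro ⟨W, rfl⟩
    exact (twoBlock_mul_stiefelBase_eq_iff hk).2 rfl

/-- A matrix which maps the columns of `J` to those of `X` and the orthogonal complement of the
former to that of the latter, when the columns of `J` and of `X` are orthonormal. Near `J` its
unitary polar factor is an element of `Sp(n)` moving `J` to `X`. -/
noncomputable def stiefelTransport {n k : ℕ} (J X : QMat n k) : QMat n n :=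
  X * Jᴴ + (1 - X * Xᴴ) * (1 - J * Jᴴ)

theorem contDiffAt_stiefelTransport {n k : ℕ} (J X : QMat n k) :
    ContDiffAt ℝ ω (stiefelTransport J) X :=
  (contDiffAt_matrix_mul contDiffAt_id contDiffAt_const).add <|
    contDiffAt_matrix_mul (contDiffAt_const.sub
      (contDiffAt_matrix_mul contDiffAt_id (contDiffAt_matrix_conjTranspose contDiffAt_id)))
      contDiffAt_const

theorem stiefelTransport_mul {n k : ℕ} {J : QMat n k} (hJ : Jᴴ * J = 1) (X : QMat n k) :
    stiefelTransport J X * J = X := by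
  simp only [stiefelTransport, Matrix.add_mul, Matrix.mul_assoc, Matrix.sub_mul, hJ,
    Matrix.mul_one, Matrix.one_mul, sub_self, Matrix.mul_zero, add_zero]

theorem conjTranspose_stiefelTransport_mul {n k : ℕ} (J : QMat n k) {X : QMat n k}
    (hX : Xᴴ * X = 1) : (stiefelTransport J X)ᴴ * X = J := by
  simp only [stiefelTransport, conjTranspose_add, conjTranspose_mul, conjTranspose_sub,
    conjTranspose_one, conjTranspose_conjTranspose, Matrix.add_mul, Matrix.mul_assoc,
    Matrix.sub_mul, hX, Matrix.mul_one, Matrix.one_mul, sub_self, add_zero]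

theorem stiefelTransport_self {n k : ℕ} {J : QMat n k} (hJ : Jᴴ * J = 1) :
    stiefelTransport J J = 1 := by
  have hidem : J * Jᴴ * (J * Jᴴ) = J * Jᴴ := by
    rw [Matrix.mul_assoc, ← Matrix.mul_assoc Jᴴ, hJ, Matrix.one_mul]
  calc stiefelTransport J J = 1 - J * Jᴴ + J * Jᴴ * (J * Jᴴ) := by
        rw [stiefelTransport]; noncomm_ring
    _ = 1 := by rw [hidem, sub_add_cancel]

theorem exists_stiefel_section {n k : ℕ} {J : QMat n k} (hJ : Jᴴ * J = 1) :
    ∃ σ : QMat n k → QMat n n, ContDiffAt ℝ ω σ J ∧ σ J = 1 ∧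
      ∀ᶠ X in 𝓝 J, σ X ∈ unitary (QMat n n) ∧ (Xᴴ * X = 1 → σ X * J = X) := by
  obtain ⟨pol, hpol, hpol1, hpol_prop⟩ := exists_contDiffAt_polar ℍ[ℝ] (Fin n)
  have hW := contDiffAt_stiefelTransport J J
  have hWJ := stiefelTransport_self hJ
  have tendsto_W : Tendsto (stiefelTransport J) (𝓝 J) (𝓝 1) := by
    have := hW.continuousAt
    rwa [ContinuousAt, hWJ] at this
  refine ⟨pol ∘ stiefelTransport J, ContDiffAt.comp J (by rwa [hWJ]) hW,
    (congrArg pol hWJ).trans hpol1, ?_⟩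
  filter_upwards [tendsto_W.eventually hpol_prop] with X hX_pol
  obtain ⟨hunit, -, hfix⟩ := hX_pol
  refine ⟨hunit, fun hX => ?_⟩
  set W := stiefelTransport J X
  have hWX : W * J = X := stiefelTransport_mul hJ X
  have hgram : Wᴴ * W * (J * Jᴴ) = J * Jᴴ := by
    rw [Matrix.mul_assoc, ← Matrix.mul_assoc W, hWX, ← Matrix.mul_assoc,
      conjTranspose_stiefelTransport_mul J hX]
  calc pol W * J = pol W * (J * Jᴴ) * J := by simp only [Matrix.mul_assoc, hJ, Matrix.mul_one]
    _ = W * (J * Jᴴ) * J := by rw [hfix _ hgram]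
    _ = X := by simp only [Matrix.mul_assoc, hJ, Matrix.mul_one, hWX]

theorem contDiff_submatrix_castLE {n k : ℕ} (hk : k ≤ n) :
    ContDiff ℝ ω fun Q : QMat n n => Q.submatrix id (Fin.castLE hk) :=
  contDiff_pi.2 fun i => contDiff_pi.2 fun j =>
    contDiff_apply_apply (𝕜 := ℝ) (E := ℍ[ℝ]) i (Fin.castLE hk j)

theorem isLinearOrbit_quatStiefel {n k : ℕ} (hk : k ≤ n) :
    IsLinearOrbit (Subtype.val : CompactSp n → QMat n n) (quatStiefel n k)
      (fun Q => Q.submatrix id (Fin.castLE hk)) ⟨stiefelBase hk, stiefelBase_mem hk⟩ where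
  isEmbedding := .subtypeVal
  exists_leftMul Q := ⟨(mulLeftEquiv Q n).toContinuousLinearMap, fun _ => rfl⟩
  contDiff := contDiff_submatrix_castLE hk
  apply_eq Q := (mul_stiefelBase hk Q).symm
  isPretransitive := .of_orbit (x₀ := ⟨stiefelBase hk, stiefelBase_mem hk⟩) fun X => by
    obtain ⟨Q, hQ⟩ := exists_mul_stiefelBase_eq hk X X.2
    exact ⟨Q, Subtype.ext hQ⟩
  exists_linearEquiv Q := ⟨mulLeftEquiv Q k, fun _ => rfl⟩
  exists_section := by
    obtain ⟨σ, hσ, hσ1, hσX⟩ := exists_stiefel_section (stiefelBase_mem hk)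
    refine ⟨σ, hσ, hσ1, hσX.mono fun X hX => ⟨⟨⟨_, hX.1⟩, rfl⟩, fun hXS => ?_⟩⟩
    rw [← mul_stiefelBase, hX.2 hXS]

theorem isEquivariantModel_quatStiefel {n k : ℕ} (hk : k ≤ n) :
    IsEquivariantModel (quatStiefel n k) (stiefelSubgroup hk)
      fun Q : CompactSp n => (Q : QMat n n).submatrix id (Fin.castLE hk) :=
  (isLinearOrbit_quatStiefel hk).isEquivariantModel <| Subgroup.ext fun _ =>
    MulAction.mem_stabilizer_iff.trans <| Subtype.ext_iff.trans (mul_stiefelBase_eq_iff_mem hk)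

end Stiefel

/-! ### Spectral projections and intertwiners -/

section SpectralProjection

open Polynomial Lagrange

variable {F A : Type*} [Field F] [DecidableEq F] [Ring A] [Algebra F A] {s : Finset F} {a b : A}
  {c : F}

theorem nodal_dvd_sub_C_eval_mul_basis (hc : c ∈ s) (p : F[X]) :
    nodal s id ∣ (p - C (p.eval c)) * Lagrange.basis s id c := by
  rw [nodal_eq_mul_nodal_erase hc, basis_eq_prod_sub_inv_mul_nodal_div hc,
    ← nodal_erase_eq_nodal_div hc]
  exact mul_dvd_mul X_sub_C_dvd_sub_C_eval (dvd_mul_left _ _)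

/-- The projection onto the `c`-eigenspace of an element `a` annihilated by `∏ e ∈ s, (X - e)`, as a
Lagrange basis polynomial in `a`. -/
noncomputable def spectralProjection (s : Finset F) (a : A) (c : F) : A :=
  aeval a (Lagrange.basis s id c)

theorem aeval_mul_spectralProjection (ha : aeval a (nodal s id) = 0) (hc : c ∈ s) (p : F[X]) :
    aeval a p * spectralProjection s a c = p.eval c • spectralProjection s a c := by
  have h := aeval_eq_zero_of_dvd_aeval_eq_zero (nodal_dvd_sub_C_eval_mul_basis hc p) ha
  rwa [map_mul, map_sub, aeval_C, sub_mul, ← Algebra.smul_def, sub_eq_zero] at h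

theorem mul_spectralProjection (ha : aeval a (nodal s id) = 0) (hc : c ∈ s) :
    a * spectralProjection s a c = c • spectralProjection s a c := by
  simpa only [aeval_X, eval_X] using aeval_mul_spectralProjection ha hc X

theorem spectralProjection_mul (ha : aeval a (nodal s id) = 0) (hc : c ∈ s) :
    spectralProjection s a c * a = c • spectralProjection s a c := by
  rw [← mul_spectralProjection ha hc]
  simpa only [spectralProjection, aeval_X] using
    ((Commute.all (Lagrange.basis s id c) X).map (aeval a)).eq

theorem spectralProjection_mul_self (ha : aeval a (nodal s id) = 0) (hc : c ∈ s) :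
    spectralProjection s a c * spectralProjection s a c = spectralProjection s a c := by
  have heval : (Lagrange.basis s id c).eval c = 1 :=
    eval_basis_self Function.injective_id.injOn hc
  exact (aeval_mul_spectralProjection ha hc _).trans (by rw [heval, one_smul])

theorem sum_spectralProjection (ha : aeval a (nodal s id) = 0) :
    ∑ c ∈ s, spectralProjection s a c = 1 := by
  rcases s.eq_empty_or_nonempty with rfl | hs
  · rw [nodal_empty, map_one] at ha
    rw [Finset.sum_empty, ha]
  · simp only [spectralProjection]
    rw [← map_sum, sum_basis Function.injective_id.injOn hs, map_one]

/-- The sum of the products of corresponding spectral projections of `b` and of `a`. It maps the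
eigenspaces of `a` to those of `b`, hence intertwines `a` and `b`. -/
noncomputable def spectralIntertwiner (s : Finset F) (a b : A) : A :=
  ∑ c ∈ s, spectralProjection s b c * spectralProjection s a c

theorem mul_spectralIntertwiner (ha : aeval a (nodal s id) = 0) (hb : aeval b (nodal s id) = 0) :
    b * spectralIntertwiner s a b = spectralIntertwiner s a b * a := by
  rw [spectralIntertwiner, Finset.mul_sum, Finset.sum_mul]
  refine Finset.sum_congr rfl fun c hc => ?_
  rw [← mul_assoc, mul_spectralProjection hb hc, mul_assoc, spectralProjection_mul ha hc,
    smul_mul_assoc, mul_smul_comm]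

theorem spectralIntertwiner_self (ha : aeval a (nodal s id) = 0) :
    spectralIntertwiner s a a = 1 :=
  (Finset.sum_congr rfl fun _ hc => spectralProjection_mul_self ha hc).trans
    (sum_spectralProjection ha)

end SpectralProjection

theorem commute_star_mul_self_of_mul_eq_mul {R : Type*} [Semigroup R] [StarMul R] {a b w : R}
    (ha : IsSelfAdjoint a) (hb : IsSelfAdjoint b) (h : b * w = w * a) :
    Commute (star w * w) a := by
  have hstar : star w * b = a * star w := by
    simpa only [star_mul, ha.star_eq, hb.star_eq] using congrArg star h
  rw [Commute, SemiconjBy, mul_assoc, ← h, ← mul_assoc, hstar, mul_assoc]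

theorem contDiff_matrix_aeval {R ι : Type*} [NormedRing R] [NormedAlgebra ℝ R] [Fintype ι]
    [DecidableEq ι] (p : Polynomial ℝ) :
    ContDiff ℝ ω fun X : Matrix ι ι R => Polynomial.aeval X p := by
  rw [contDiff_iff_contDiffAt]
  intro X
  induction p using Polynomial.induction_on' with
  | add p q hp hq =>
    simp only [map_add]
    exact hp.add hq
  | monomial k a =>
    simp only [Polynomial.aeval_monomial]
    refine contDiffAt_matrix_mul contDiffAt_const ?_
    induction k with
    | zero => simpa only [pow_zero] using contDiffAt_const
    | succ k ih =>
      simp only [pow_succ]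
      exact contDiffAt_matrix_mul ih contDiffAt_id

/-! ### Conjugation orbits -/

section ConjugationOrbit

open Filter Topology Matrix Polynomial Lagrange

/-- Conjugation by an element of `Sp(n)`, as a linear automorphism of `ℍ^{n × n}`. -/
noncomputable def conjEquiv {n : ℕ} (Q : CompactSp n) : QMat n n ≃L[ℝ] QMat n n :=
  (Unitary.conjStarAlgAut ℝ (QMat n n) Q).toAlgEquiv.toLinearEquiv.toContinuousLinearEquiv

variable {n : ℕ} {D : QMat n n} {s : Finset ℝ}

theorem exists_conj_section (hD : Dᴴ = D) (hs : aeval D (nodal s id) = 0) :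
    ∃ σ : QMat n n → QMat n n, ContDiffAt ℝ ω σ D ∧ σ D = 1 ∧
      ∀ᶠ X in 𝓝 D, σ X ∈ unitary (QMat n n) ∧
        (Xᴴ = X → aeval X (nodal s id) = 0 → σ X * D * (σ X)ᴴ = X) := by
  obtain ⟨pol, hpol, hpol1, hpol_prop⟩ := exists_contDiffAt_polar ℍ[ℝ] (Fin n)
  have hW : ContDiffAt ℝ ω (spectralIntertwiner s D) D :=
    ContDiffAt.sum fun c _ =>
      contDiffAt_matrix_mul (contDiff_matrix_aeval _).contDiffAt contDiffAt_const
  have hWD := spectralIntertwiner_self hs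
  have tendsto_W : Tendsto (spectralIntertwiner s D) (𝓝 D) (𝓝 1) := by
    have := hW.continuousAt
    rwa [ContinuousAt, hWD] at this
  refine ⟨pol ∘ spectralIntertwiner s D, ContDiffAt.comp D (by rwa [hWD]) hW,
    (congrArg pol hWD).trans hpol1, ?_⟩
  filter_upwards [tendsto_W.eventually hpol_prop] with X hX_pol
  obtain ⟨hunit, hcomm, -⟩ := hX_pol
  refine ⟨hunit, fun hX hXs => ?_⟩
  have hWX := mul_spectralIntertwiner hs hXs
  set W := spectralIntertwiner s D X
  have hXpol : X * pol W = pol W * D :=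
    hcomm X D (commute_star_mul_self_of_mul_eq_mul hD hX hWX) hWX
  calc pol W * D * (pol W)ᴴ = X * (pol W * star (pol W)) := by
        rw [← hXpol, mul_assoc, star_eq_conjTranspose]
    _ = X := by rw [Unitary.mul_star_self_of_mem hunit, mul_one]

theorem aeval_eq_zero_of_mem_quatConjOrbit {p : ℝ[X]} (hp : aeval D p = 0) {X : QMat n n}
    (hX : X ∈ quatConjOrbit D) : aeval X p = 0 := by
  obtain ⟨-, Q, rfl⟩ := hX
  have := aeval_algHom_apply (Unitary.conjStarAlgAut ℝ (QMat n n) Q).toAlgEquiv D p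
  rw [hp, map_zero] at this
  exact this

theorem mem_quatConjOrbit_self (hD : Dᴴ = D) : D ∈ quatConjOrbit D :=
  ⟨hD, 1, by rw [Submonoid.coe_one, one_mul, conjTranspose_one, mul_one]⟩

theorem isLinearOrbit_quatConjOrbit (hD : Dᴴ = D) (hs : aeval D (nodal s id) = 0) :
    IsLinearOrbit (Subtype.val : CompactSp n → QMat n n) (quatConjOrbit D)
      (fun Q => Q * D * Qᴴ) ⟨D, mem_quatConjOrbit_self hD⟩ where
  isEmbedding := .subtypeVal
  exists_leftMul Q := ⟨(mulLeftEquiv Q n).toContinuousLinearMap, fun _ => rfl⟩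
  contDiff := contDiff_iff_contDiffAt.2 fun _ =>
    contDiffAt_matrix_mul (contDiffAt_matrix_mul contDiffAt_id contDiffAt_const)
      (contDiffAt_matrix_conjTranspose contDiffAt_id)
  apply_eq _ := rfl
  isPretransitive := .of_orbit (x₀ := ⟨D, mem_quatConjOrbit_self hD⟩) fun X => by
    obtain ⟨-, Q, hQ⟩ := X.2
    exact ⟨Q, Subtype.ext hQ.symm⟩
  exists_linearEquiv Q := ⟨conjEquiv Q, fun _ => rfl⟩
  exists_section := by
    obtain ⟨σ, hσ, hσ1, hσX⟩ := exists_conj_section hD hs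
    exact ⟨σ, hσ, hσ1, hσX.mono fun X hX => ⟨⟨⟨_, hX.1⟩, rfl⟩, fun hXS =>
      hX.2 hXS.1 (aeval_eq_zero_of_mem_quatConjOrbit hs hXS)⟩⟩

theorem mul_mul_conjTranspose_eq_self_iff (Q : CompactSp n) :
    (Q : QMat n n) * D * (Q : QMat n n)ᴴ = D ↔ Commute (Q : QMat n n) D := by
  rw [Commute, SemiconjBy, ← (Unitary.isUnit_coe (U := Q)).mul_left_inj, mul_assoc (_ * D),
    mem_compactSp_iff.1 Q.2, mul_one]

theorem isEquivariantModel_quatConjOrbit (hD : Dᴴ = D) (hs : aeval D (nodal s id) = 0)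
    {H : Subgroup (CompactSp n)} (hH : ∀ Q : CompactSp n, Q ∈ H ↔ Commute (Q : QMat n n) D) :
    IsEquivariantModel (quatConjOrbit D) H
      fun Q : CompactSp n => (Q : QMat n n) * D * (Q : QMat n n)ᴴ :=
  (isLinearOrbit_quatConjOrbit hD hs).isEquivariantModel <| Subgroup.ext fun Q =>
    MulAction.mem_stabilizer_iff.trans <| Subtype.ext_iff.trans <|
      (mul_mul_conjTranspose_eq_self_iff Q).trans (hH Q).symm

end ConjugationOrbit

/-! ### Real diagonal matrices -/

section RealDiagonal

open Matrix Polynomial Lagrange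

/-- The quaternionic diagonal matrix with real diagonal entries `d i`. -/
noncomputable def realDiagonal {n : ℕ} (d : Fin n → ℝ) : QMat n n :=
  diagonal fun i => algebraMap ℝ ℍ[ℝ] (d i)

variable {n : ℕ} (d : Fin n → ℝ)

theorem realDiagonal_conjTranspose : (realDiagonal d)ᴴ = realDiagonal d := by
  rw [realDiagonal, diagonal_conjTranspose]
  exact congrArg diagonal (funext fun i => Quaternion.star_coe (d i))

theorem aeval_realDiagonal (p : ℝ[X]) :
    aeval (realDiagonal d) p = realDiagonal fun i => p.eval (d i) := by
  have hd : aeval d p = fun i => p.eval (d i) := funext fun i => by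
    rw [← coe_aeval_eq_eval]
    exact (aeval_algHom_apply (Pi.evalAlgHom ℝ (fun _ : Fin n => ℝ) i) d p).symm
  exact (aeval_algHom_apply ((diagonalAlgHom ℝ).comp ((Algebra.ofId ℝ ℍ[ℝ]).compLeft (Fin n)))
    d p).trans (by rw [hd]; rfl)

theorem aeval_realDiagonal_nodal : aeval (realDiagonal d) (nodal (Finset.univ.image d) id) = 0 := by
  rw [aeval_realDiagonal]
  have (i : Fin n) : (nodal (Finset.univ.image d) id).eval (d i) = 0 :=
    eval_nodal_at_node (v := id) (Finset.mem_image_of_mem d (Finset.mem_univ i))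
  simp only [realDiagonal, this, map_zero, diagonal_zero]

theorem commute_realDiagonal_iff {Q : QMat n n} :
    Commute Q (realDiagonal d) ↔ ∀ i j, d i ≠ d j → Q i j = 0 := by
  refine Matrix.ext_iff.symm.trans (forall₂_congr fun i j => ?_)
  rw [realDiagonal, mul_diagonal, diagonal_mul, ← Algebra.commutes (d j), ← sub_eq_zero, ← sub_mul,
    ← map_sub, ← Algebra.smul_def, smul_eq_zero, sub_eq_zero]
  tauto

theorem isEquivariantModel_quatConjOrbit_realDiagonal {H : Subgroup (CompactSp n)}
    (hH : ∀ Q : CompactSp n, Q ∈ H ↔ ∀ i j, d i ≠ d j → (Q : QMat n n) i j = 0) :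
    IsEquivariantModel (quatConjOrbit (realDiagonal d)) H
      fun Q : CompactSp n => (Q : QMat n n) * realDiagonal d * (Q : QMat n n)ᴴ :=
  isEquivariantModel_quatConjOrbit (realDiagonal_conjTranspose d) (aeval_realDiagonal_nodal d)
    fun Q => (hH Q).trans (commute_realDiagonal_iff d).symm

end RealDiagonal

/-! ### The Grassmann and flag manifolds -/

section GrassmannFlag

open Matrix

theorem grassmannDelta_eq_realDiagonal {n k : ℕ} (hk : k ≤ n) : grassmannDelta hk =
    realDiagonal fun i => Sum.elim (fun _ => 1) (fun _ => -1) ((twoBlockEquiv hk).symm i) := by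
  refine Matrix.ext fun i j => ?_
  obtain ⟨x, rfl⟩ := (twoBlockEquiv hk).surjective i
  obtain ⟨y, rfl⟩ := (twoBlockEquiv hk).surjective j
  rw [grassmannDelta, twoBlock_apply, realDiagonal, diagonal_apply]
  rcases x with x | x <;> rcases y with y | y <;> simp [Matrix.one_apply]
  split <;> simp

theorem mem_grassmannSubgroup_iff {n k : ℕ} (hk : k ≤ n) (Q : CompactSp n) :
    Q ∈ grassmannSubgroup hk ↔ ∀ i j,
      (Sum.elim (fun _ => 1) (fun _ => -1) ((twoBlockEquiv hk).symm i) : ℝ) ≠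
        Sum.elim (fun _ => 1) (fun _ => -1) ((twoBlockEquiv hk).symm j) →
      (Q : QMat n n) i j = 0 := by
  constructor
  · rintro ⟨W, rfl⟩ i j
    obtain ⟨x, rfl⟩ := (twoBlockEquiv hk).surjective i
    obtain ⟨y, rfl⟩ := (twoBlockEquiv hk).surjective j
    change _ → twoBlock hk (W.1 : QMat k k) (W.2 : QMat (n - k) (n - k)) _ _ = 0
    rw [twoBlock_apply]
    rcases x with x | x <;> rcases y with y | y <;> simp
  · intro h
    obtain ⟨A, B, hAB⟩ := exists_twoBlock_eq hk (M := Q)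
      (fun i j => h _ _ (by norm_num)) (fun i j => h _ _ (by norm_num))
    obtain ⟨W, hW, -⟩ := exists_twoBlockHom_eq hk hAB
    exact ⟨W, hW⟩

theorem flagDelta_eq_realDiagonal {n p : ℕ} {k : Fin p → ℕ} (hk : StrictMono k)
    (hn : ∀ j, k j < n) (a : Fin (p + 1) → ℝ) :
    flagDelta hk hn a = realDiagonal fun i => a ((flagEquiv hk hn).symm i).1 := by
  refine Matrix.ext fun i j => ?_
  obtain ⟨⟨x₁, x₂⟩, rfl⟩ := (flagEquiv hk hn).surjective i
  obtain ⟨⟨y₁, y₂⟩, rfl⟩ := (flagEquiv hk hn).surjective j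
  rw [flagDelta, flagBlock_apply, realDiagonal, diagonal_apply]
  by_cases hxy : x₁ = y₁
  · subst hxy
    rw [blockDiagonal'_apply_eq, Matrix.smul_apply, Matrix.one_apply]
    by_cases hxy₂ : x₂ = y₂
    · simp [hxy₂, Algebra.algebraMap_eq_smul_one]
    · simp [hxy₂]
  · rw [blockDiagonal'_apply_ne _ _ _ hxy]
    simp [hxy]

theorem mem_flagSubgroup_iff {n p : ℕ} {k : Fin p → ℕ} (hk : StrictMono k) (hn : ∀ j, k j < n)
    {a : Fin (p + 1) → ℝ} (ha : Function.Injective a) (Q : CompactSp n) :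
    Q ∈ flagSubgroup hk hn ↔ ∀ i j,
      a ((flagEquiv hk hn).symm i).1 ≠ a ((flagEquiv hk hn).symm j).1 →
      (Q : QMat n n) i j = 0 := by
  constructor
  · rintro ⟨W, rfl⟩ i j hij
    obtain ⟨x, rfl⟩ := (flagEquiv hk hn).surjective i
    obtain ⟨y, rfl⟩ := (flagEquiv hk hn).surjective j
    rw [Equiv.symm_apply_apply, Equiv.symm_apply_apply] at hij
    change flagBlock hk hn (fun j => (W j : QMat _ _)) _ _ = 0
    rw [flagBlock_apply]
    exact blockDiagonal'_apply_ne _ _ _ fun h => hij (congrArg a h)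
  · intro h
    obtain ⟨N, hN⟩ := exists_flagBlock_eq hk hn (M := Q) fun x y hxy => h _ _ <| by
      rw [Equiv.symm_apply_apply, Equiv.symm_apply_apply]
      exact ha.ne hxy
    exact exists_flagBlockHom_eq hk hn hN

theorem isEquivariantModel_grassmann {n k : ℕ} (hk : k ≤ n) :
    IsEquivariantModel (quatConjOrbit (grassmannDelta hk)) (grassmannSubgroup hk)
      fun Q : CompactSp n => (Q : QMat n n) * grassmannDelta hk * (Q : QMat n n)ᴴ := by
  rw [grassmannDelta_eq_realDiagonal]
  exact isEquivariantModel_quatConjOrbit_realDiagonal _ (mem_grassmannSubgroup_iff hk)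

theorem isEquivariantModel_flag {n p : ℕ} {k : Fin p → ℕ} (hk : StrictMono k)
    (hn : ∀ j, k j < n) {a : Fin (p + 1) → ℝ} (ha : Function.Injective a) :
    IsEquivariantModel (quatConjOrbit (flagDelta hk hn a)) (flagSubgroup hk hn)
      fun Q : CompactSp n => (Q : QMat n n) * flagDelta hk hn a * (Q : QMat n n)ᴴ := by
  rw [flagDelta_eq_realDiagonal]
  exact isEquivariantModel_quatConjOrbit_realDiagonal _ (mem_flagSubgroup_iff hk hn ha)

end GrassmannFlag


theorem mainTheorem11 (n : ℕ) :
    (∃ (m : ℕ) (cG : ChartedSpace (EuclideanSpace ℝ (Fin m)) (CompactSp n)),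
      IsEmbeddedStructure (Subtype.val : CompactSp n → QMat n n) m cG) ∧
    (∀ (k : ℕ) (hk : k ≤ n),
      IsEquivariantModel (quatStiefel n k) (stiefelSubgroup hk)
        (fun Q : CompactSp n => (Q : QMat n n).submatrix id (Fin.castLE hk))) ∧
    (∀ (k : ℕ) (hk : k ≤ n),
      IsEquivariantModel (quatConjOrbit (grassmannDelta hk)) (grassmannSubgroup hk)
        (fun Q : CompactSp n =>
          (Q : QMat n n) * grassmannDelta hk * (Q : QMat n n)ᴴ)) ∧
    (∀ (p : ℕ) (k : Fin p → ℕ) (hk : StrictMono k) (_ : ∀ j, 0 < k j) (hn : ∀ j, k j < n)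
      (a : Fin (p + 1) → ℝ), Function.Injective a →
      IsEquivariantModel (quatConjOrbit (flagDelta hk hn a)) (flagSubgroup hk hn)
        (fun Q : CompactSp n =>
          (Q : QMat n n) * flagDelta hk hn a * (Q : QMat n n)ᴴ)) :=
  ⟨exists_isEmbeddedStructure_compactSp n, fun _ hk => isEquivariantModel_quatStiefel hk,
    fun _ hk => isEquivariantModel_grassmann hk,
    fun _ _ hk _ hn _ ha => isEquivariantModel_flag hk hn ha⟩
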